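/- **Dynamics.** Configurations are $\underline s\in\{0,1\}^{\mathbb Z}$ ($1$ = occupied). With $\chi(s_1,s_2,s_3)=s_1+s_2+s_3+s_1s_3 \pmod 2$ (rule 54), the time evolution is $s_x^{t+1}=\chi(s^t_{x-1},s^t_x,s^t_{x+1})$ if $x+t$ is even and $s_x^{t+1}=s_x^t$ if $x+t$ is odd. At $t=0$ the sites are independent, occupied with probability $1/2$ for $x\le 0$ and empty with probability $1$ for $x>0$. Let $\hat\rho(x,t)$ ($x\in\mathbb Z$, $t\in\mathbb N_0$) be the probability that $s^t_x=1$. **Matrix product ansatz.** Let $\mathcal V$ have the orthonormal basis $|c,w,n,a\rangle$, $c,w\in\mathbb N_0$, $n\in\{0,1,2\}$, $a\in\{0,1\}$. Let $\mathbf c^+$, $\mathbf w^+$ raise $c$, $w$ by one, $\mathbf c^-=(\mathbf c^+)^T$, $\mathbf w^-=(\mathbf w^+)^T$, $\mathbf e_{n_2a_2,n_1a_1}=\sum_{c,w}|c,w,n_2,a_2\rangle\langle c,w,n_1,a_1|$, $\mathbf e_{i,j}=|i\rangle\langle j|$ for two basis labels, and $\mathbf p=\mathbf w^+\mathbf w^-$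 (the projector onto $w\ge 1$). Put $$V_0=\mathbf e_{00,00}+\mathbf e_{10,00}+\mathbf e_{20,00}+\mathbf c^+\mathbf e_{10,01}+\mathbf p\,\mathbf e_{01,01}+\mathbf c^+\mathbf w^+\mathbf e_{11,01}+\mathbf p\,\mathbf e_{21,01}+\mathbf e_{0001,0001}+\mathbf e_{0011,0001}+\mathbf e_{0021,0001},$$ $$V_1=\mathbf e_{00,10}+\mathbf e_{10,20}+\mathbf e_{20,20}+\mathbf e_{10,21}+\mathbf e_{20,21}+\mathbf p\,\mathbf e_{01,11}+\mathbf w^+\mathbf e_{11,21}+\mathbf w^+\mathbf e_{21,21}+\mathbf e_{0001,0011}+\mathbf e_{0011,0021}+\mathbf e_{0021,0021},$$ $$W_0=\mathbf c^-\mathbf w^+(\mathbf e_{00,00}+\mathbf e_{10,00}+\mathbf e_{20,00})+\mathbf w^+\mathbf e_{10,01}+\mathbf w^+\mathbf e_{01,01}+\mathbf c^+(\mathbf w^+)^2\mathbf e_{11,01}+\mathbf w^+\mathbf e_{21,01}+\mathbf e_{1111,0001}+\mathbf e_{0001,0001}+\mathbf e_{0011,0001}+\mathbf e_{0021,0001},$$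 $$W_1=\mathbf c^-\mathbf w^+(\mathbf e_{00,10}+\mathbf e_{10,20}+\mathbf e_{20,20})+\mathbf w^+\mathbf e_{01,11}+\mathbf c^+\mathbf w^+\mathbf e_{11,21}+\mathbf c^+\mathbf w^+\mathbf e_{21,21}+\mathbf e_{0001,0011}+\mathbf e_{0011,0021}+\mathbf e_{0021,0021},$$ $$V_0'=V_0^T-(\mathbf e_{0001,1111}+\mathbf e_{0101,1211}+\mathbf e_{0101,1110}),\qquad V_1'=V_1^T,$$ $$W_0'=W_0^T-(\mathbf e_{0001,1111}+\mathbf e_{0001,1211}),\qquad W_1'=W_1^T-(\mathbf e_{0021,1111}+\mathbf e_{0021,1121}+\mathbf e_{0121,1211}+\mathbf e_{0121,1221}),$$ $$\langle l(t)|=\langle 0,t,0,0|,\quad |r\rangle=\sum_{n=0}^{2}|0,0,n,1\rangle,\quad \langle l'|=\sum_{n=0}^{2}\langle 0,0,n,1|+\langle 0,1,0,1|+\langle 0,1,2,1|,\quad |r'(t)\rangle=|0,t+1,0,0\rangle .$$ For $0\le m\le t$ let $$L(m,t)=\langle l(t)|\big((V_0+V_1)(W_0+W_1)\big)^mV_0(W_0V_0)^{t-m}|r\rangle,\quad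 R(m,t)=\langle l'|\big((V_0'+V_1')(W_0'+W_1')\big)^mV_0'(W_0'V_0')^{t-m}|r'(t)\rangle,$$ $$\rho(m,t)=2^{-2m}\big(L(m,t)+R(m,t)\big).$$ **Claim.** (1) For all integers $t\ge 1$ and $0\le m\le t$, $$\begin{aligned}\rho(m,t)={}&\tfrac38\delta_{m,t}+\tfrac18(\delta_{m,1}\delta_{t,1}+\delta_{m,2}\delta_{t,2})+\tfrac14\delta_{m,3}\delta_{t,4}\\&+\theta_{2m-t-3}\,2^{t-2m}\Big(3\tbinom{2m-t-3}{t-m-1}+\tbinom{2m-t-3}{t-m-2}\Big)+\frac{1-(-\frac12)^m}{3}\\&-\frac12\sum_{y=t-m}^{m-1}2^{-(m-1-y)}\tbinom{m-1-y}{y}+\frac18\sum_{y=t-m}^{2m-t-3}2^{-(2m-t-3)}\tbinom{2m-t-3}{y}+\frac3{16}\sum_{y=0}^{2m-t-4}2^{-y}\tbinom{y}{t-m-1},\end{aligned}$$ where $\theta_x=1$ for $x\ge0$ and $\theta_x=0$ for $x<0$, a sum whose upper limit is below its lower limit is $0$, and a binomial coefficient with a negative entry is $0$. (2) The full density profile is,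 for all $x\in\mathbb Z$ and $t\in\mathbb N_0$, $$\hat\rho(x,t)=\begin{cases}\frac12,& x\le -t,\\ 0,& x\ge t,\ (x,t)\neq(0,0),\\ \rho\big(\tfrac{t-x}{2},t-1\big),& -t<x<t,\ x+t \text{ even},\\ \rho\big(\tfrac{t-x+1}{2},t\big),& -t<x<t,\ x+t\text{ odd}.\end{cases}$$ -/

import Mathlib

open MeasureTheory

noncomputable section

namespace Rule54

/-! ### The cellular automaton -/

/-- A configuration of the chain: `0` is an empty site, `1` an occupied site. -/
abbrev Config := ℤ → Fin 2

/-- The local rule `s₁ + s₂ + s₃ + s₁ s₃` modulo `2` (addition and multiplication of `Fin 2` are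
taken modulo `2`). -/
def chi (s₁ s₂ s₃ : Fin 2) : Fin 2 := s₁ + s₂ + s₃ + s₁ * s₃

/-- The update of the even sites. -/
def evenStep (s : Config) : Config := fun x =>
  if x % 2 = 0 then chi (s (x - 1)) (s x) (s (x + 1)) else s x

/-- The update of the odd sites. -/
def oddStep (s : Config) : Config := fun x =>
  if x % 2 = 0 then s x else chi (s (x - 1)) (s x) (s (x + 1))

/-- The configuration at time `t` that evolves from the configuration `s` at time `0`. -/
def evolve : ℕ → Config → Config
  | 0, s => s
  | t + 1, s => if t % 2 = 0 then evenStep (evolve t s) else oddStep (evolve t s)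

/-! ### The inhomogeneous initial state -/

/-- The one-site distributions: fair for `x ≤ 0`, almost surely empty for `x > 0`. -/
def siteLaw (x : ℤ) : Measure (Fin 2) :=
  if x ≤ 0 then (2⁻¹ : ENNReal) • Measure.dirac 0 + (2⁻¹ : ENNReal) • Measure.dirac 1
  else Measure.dirac 0

instance (x : ℤ) : IsProbabilityMeasure (siteLaw x) := by
  unfold siteLaw
  split_ifs
  · constructor
    simp [ENNReal.inv_two_add_inv_two]
  · infer_instance

/-- The initial state: all sites are independent. -/
def initialState : Measure Config := Measure.infinitePi siteLaw

/-- The density profile: the probability that site `x` is occupied at time `t`. -/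
def densityProfile (x : ℤ) (t : ℕ) : ℝ := initialState.real {s | evolve t s x = 1}

/-! ### The auxiliary space of the matrix product ansatz -/

/-- The labels `(c, w, n, a)` of the basis of the auxiliary space. -/
abbrev Label := ℕ × ℕ × Fin 3 × Fin 2

/-- The auxiliary space: finite linear combinations of the basis vectors. -/
abbrev Aux := Label →₀ ℝ

/-- The linear operators of the auxiliary space. -/
abbrev Op := Module.End ℝ Aux

/-- The basis vector `|c, w, n, a⟩`. -/
def ket (c w : ℕ) (n : Fin 3) (a : Fin 2) : Aux := Finsupp.single (c, w, n, a) 1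

/-- The operator with prescribed values on the basis vectors. -/
def opOf (f : Label → Aux) : Op := Finsupp.linearCombination ℝ f

/-- The pairing `⟨u|v⟩` in which the basis vectors are orthonormal. -/
def bracket (u v : Aux) : ℝ := u.sum fun i r => r * v i

/-- `𝐜⁺`. -/
def cUp : Op := opOf fun i => ket (i.1 + 1) i.2.1 i.2.2.1 i.2.2.2

/-- `𝐜⁻`. -/
def cDown : Op := opOf fun i => if i.1 = 0 then 0 else ket (i.1 - 1) i.2.1 i.2.2.1 i.2.2.2

/-- `𝐰⁺`. -/
def wUp : Op := opOf fun i => ket i.1 (i.2.1 + 1) i.2.2.1 i.2.2.2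

/-- `𝐰⁻`. -/
def wDown : Op := opOf fun i => if i.2.1 = 0 then 0 else ket i.1 (i.2.1 - 1) i.2.2.1 i.2.2.2

/-- `𝐞_{n₂a₂,n₁a₁} = ∑_{c,w} |c,w,n₂,a₂⟩⟨c,w,n₁,a₁|`. -/
def e (n₂ : Fin 3) (a₂ : Fin 2) (n₁ : Fin 3) (a₁ : Fin 2) : Op :=
  opOf fun i => if i.2.2.1 = n₁ ∧ i.2.2.2 = a₁ then ket i.1 i.2.1 n₂ a₂ else 0

/-- `𝐞_{i,j} = |i⟩⟨j|` for two basis labels. -/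
def E (i j : Label) : Op := opOf fun k => if k = j then Finsupp.single i 1 else 0

/-! ### The matrices of the left movers -/

def V0 : Op :=
  e 0 0 0 0 + e 1 0 0 0 + e 2 0 0 0 + cUp * e 1 0 0 1
  + wUp * wDown * e 0 1 0 1 + cUp * wUp * e 1 1 0 1 + wUp * wDown * e 2 1 0 1
  + E (0, 0, 0, 1) (0, 0, 0, 1) + E (0, 0, 1, 1) (0, 0, 0, 1) + E (0, 0, 2, 1) (0, 0, 0, 1)

def V1 : Op :=
  e 0 0 1 0 + e 1 0 2 0 + e 2 0 2 0 + e 1 0 2 1 + e 2 0 2 1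
  + wUp * wDown * e 0 1 1 1 + wUp * e 1 1 2 1 + wUp * e 2 1 2 1
  + E (0, 0, 0, 1) (0, 0, 1, 1) + E (0, 0, 1, 1) (0, 0, 2, 1) + E (0, 0, 2, 1) (0, 0, 2, 1)

def W0 : Op :=
  cDown * wUp * (e 0 0 0 0 + e 1 0 0 0 + e 2 0 0 0) + wUp * e 1 0 0 1
  + wUp * e 0 1 0 1 + cUp * wUp ^ 2 * e 1 1 0 1 + wUp * e 2 1 0 1
  + E (1, 1, 1, 1) (0, 0, 0, 1)
  + E (0, 0, 0, 1) (0, 0, 0, 1) + E (0, 0, 1, 1) (0, 0, 0, 1) + E (0, 0, 2, 1) (0, 0, 0, 1)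

def W1 : Op :=
  cDown * wUp * (e 0 0 1 0 + e 1 0 2 0 + e 2 0 2 0)
  + wUp * e 0 1 1 1 + cUp * wUp * e 1 1 2 1 + cUp * wUp * e 2 1 2 1
  + E (0, 0, 0, 1) (0, 0, 1, 1) + E (0, 0, 1, 1) (0, 0, 2, 1) + E (0, 0, 2, 1) (0, 0, 2, 1)

/-! ### Their transposes, written out term by term -/

def V0T : Op :=
  e 0 0 0 0 + e 0 0 1 0 + e 0 0 2 0 + e 0 1 1 0 * cDown
  + e 0 1 0 1 * (wUp * wDown) + e 0 1 1 1 * (wDown * cDown) + e 0 1 2 1 * (wUp * wDown)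
  + E (0, 0, 0, 1) (0, 0, 0, 1) + E (0, 0, 0, 1) (0, 0, 1, 1) + E (0, 0, 0, 1) (0, 0, 2, 1)

def V1T : Op :=
  e 1 0 0 0 + e 2 0 1 0 + e 2 0 2 0 + e 2 1 1 0 + e 2 1 2 0
  + e 1 1 0 1 * (wUp * wDown) + e 2 1 1 1 * wDown + e 2 1 2 1 * wDown
  + E (0, 0, 1, 1) (0, 0, 0, 1) + E (0, 0, 2, 1) (0, 0, 1, 1) + E (0, 0, 2, 1) (0, 0, 2, 1)

def W0T : Op :=
  (e 0 0 0 0 + e 0 0 1 0 + e 0 0 2 0) * (wDown * cUp) + e 0 1 1 0 * wDown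
  + e 0 1 0 1 * wDown + e 0 1 1 1 * (wDown ^ 2 * cDown) + e 0 1 2 1 * wDown
  + E (0, 0, 0, 1) (1, 1, 1, 1)
  + E (0, 0, 0, 1) (0, 0, 0, 1) + E (0, 0, 0, 1) (0, 0, 1, 1) + E (0, 0, 0, 1) (0, 0, 2, 1)

def W1T : Op :=
  (e 1 0 0 0 + e 2 0 1 0 + e 2 0 2 0) * (wDown * cUp)
  + e 1 1 0 1 * wDown + e 2 1 1 1 * (wDown * cDown) + e 2 1 2 1 * (wDown * cDown)
  + E (0, 0, 1, 1) (0, 0, 0, 1) + E (0, 0, 2, 1) (0, 0, 1, 1) + E (0, 0, 2, 1) (0, 0, 2, 1)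

/-- `B` is the transpose of `A`. -/
def IsTranspose (A B : Op) : Prop := ∀ u v : Aux, bracket u (A v) = bracket (B u) v

theorem bracket_eq (u v : Aux) :
    bracket u v = Finsupp.linearCombination ℝ (fun i => v i) u := by
  simp [bracket, Finsupp.linearCombination_apply]

theorem bracket_add (w a b : Aux) : bracket w (a + b) = bracket w a + bracket w b := by
  simp only [bracket, Finsupp.add_apply, mul_add]
  exact Finsupp.sum_add

theorem isTranspose_of_basis {A B : Op}
    (h : ∀ i j : Label, A (Finsupp.single j 1) i = B (Finsupp.single i 1) j) :
    IsTranspose A B := by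
  intro u v
  induction u using Finsupp.induction_linear with
  | zero => simp [bracket_eq]
  | add f g hf hg =>
    simp only [bracket_eq] at hf hg ⊢
    rw [map_add, hf, hg, map_add, map_add]
  | single i r =>
    induction v using Finsupp.induction_linear with
    | zero => simp [bracket, Finsupp.sum]
    | add f g hf hg =>
      rw [map_add]
      rw [bracket_add, bracket_add, hf, hg]
    | single j q =>
      have e1 : (Finsupp.single i r : Aux) = r • Finsupp.single i 1 := by simp
      have e2 : (Finsupp.single j q : Aux) = q • Finsupp.single j 1 := by simp
      have l1 : bracket (Finsupp.single i r) (A (Finsupp.single j q))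
          = r * (q * A (Finsupp.single j 1) i) := by
        rw [e2, map_smul]
        simp [bracket]
      have l2 : ∀ w : Aux, bracket w (Finsupp.single j q) = q * w j := by
        intro w
        classical
        simp only [bracket, Finsupp.sum]
        rw [Finset.sum_eq_single j]
        · simp [mul_comm]
        · intro b _ hb
          simp [hb.symm]
        · intro hj
          simp [Finsupp.notMem_support_iff.mp hj]
      rw [l1, l2, e1, map_smul, h]
      simp only [Finsupp.smul_apply, smul_eq_mul]
      ring

theorem IsTranspose.add {A B A' B' : Op} (h : IsTranspose A B) (h' : IsTranspose A' B') :
    IsTranspose (A + A') (B + B') := by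
  intro u v
  rw [LinearMap.add_apply, LinearMap.add_apply, bracket_add, h u v, h' u v]
  simp [bracket_eq]

theorem IsTranspose.mul {A B A' B' : Op} (h : IsTranspose A B) (h' : IsTranspose A' B') :
    IsTranspose (A * A') (B' * B) := by
  intro u v
  rw [Module.End.mul_apply, Module.End.mul_apply, h, h']

theorem isTranspose_c : IsTranspose cUp cDown := by
  apply isTranspose_of_basis
  rintro ⟨c, w, n, a⟩ ⟨c', w', n', a'⟩
  rcases c with _ | c <;>
    simp [cUp, cDown, opOf, ket, Finsupp.single_apply, eq_comm]

theorem isTranspose_c' : IsTranspose cDown cUp := by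
  apply isTranspose_of_basis
  rintro ⟨c, w, n, a⟩ ⟨c', w', n', a'⟩
  rcases c' with _ | c' <;>
    simp [cUp, cDown, opOf, ket, Finsupp.single_apply, eq_comm]

theorem isTranspose_w : IsTranspose wUp wDown := by
  apply isTranspose_of_basis
  rintro ⟨c, w, n, a⟩ ⟨c', w', n', a'⟩
  rcases w with _ | w <;>
    simp [wUp, wDown, opOf, ket, Finsupp.single_apply, eq_comm]

theorem isTranspose_w' : IsTranspose wDown wUp := by
  apply isTranspose_of_basis
  rintro ⟨c, w, n, a⟩ ⟨c', w', n', a'⟩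
  rcases w' with _ | w' <;>
    simp [wUp, wDown, opOf, ket, Finsupp.single_apply, eq_comm]

theorem isTranspose_e (n₂ : Fin 3) (a₂ : Fin 2) (n₁ : Fin 3) (a₁ : Fin 2) :
    IsTranspose (e n₂ a₂ n₁ a₁) (e n₁ a₁ n₂ a₂) := by
  apply isTranspose_of_basis
  rintro ⟨c, w, n, a⟩ ⟨c', w', n', a'⟩
  simp only [e, opOf, ket, Finsupp.linearCombination_single, one_smul]
  split_ifs <;> simp [Finsupp.single_apply] <;> grind

theorem isTranspose_E (i j : Label) : IsTranspose (E i j) (E j i) := by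
  apply isTranspose_of_basis
  intro k l
  simp only [E, opOf, Finsupp.linearCombination_single, one_smul]
  split_ifs <;> simp [Finsupp.single_apply] <;> grind

theorem isTranspose_ww : IsTranspose (wUp * wDown) (wUp * wDown) :=
  isTranspose_w.mul isTranspose_w'

theorem isTranspose_V0 : IsTranspose V0 V0T := by
  unfold V0 V0T
  refine (((((((((isTranspose_e _ _ _ _).add (isTranspose_e _ _ _ _)).add (isTranspose_e _ _ _ _)).add
    (isTranspose_c.mul (isTranspose_e _ _ _ _))).add (isTranspose_ww.mul (isTranspose_e _ _ _ _))).add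
    ((isTranspose_c.mul isTranspose_w).mul (isTranspose_e _ _ _ _))).add
    (isTranspose_ww.mul (isTranspose_e _ _ _ _))).add (isTranspose_E _ _)).add (isTranspose_E _ _)).add
    (isTranspose_E _ _)

theorem isTranspose_V1 : IsTranspose V1 V1T := by
  unfold V1 V1T
  refine ((((((((((isTranspose_e _ _ _ _).add (isTranspose_e _ _ _ _)).add (isTranspose_e _ _ _ _)).add
    (isTranspose_e _ _ _ _)).add (isTranspose_e _ _ _ _)).add (isTranspose_ww.mul (isTranspose_e _ _ _ _))).add
    (isTranspose_w.mul (isTranspose_e _ _ _ _))).add (isTranspose_w.mul (isTranspose_e _ _ _ _))).add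
    (isTranspose_E _ _)).add (isTranspose_E _ _)).add (isTranspose_E _ _)

theorem isTranspose_W0 : IsTranspose W0 W0T := by
  unfold W0 W0T
  rw [pow_two, pow_two]
  refine ((((((((((isTranspose_c'.mul isTranspose_w).mul
    (((isTranspose_e _ _ _ _).add (isTranspose_e _ _ _ _)).add (isTranspose_e _ _ _ _))).add
    (isTranspose_w.mul (isTranspose_e _ _ _ _))).add (isTranspose_w.mul (isTranspose_e _ _ _ _))).add
    ((isTranspose_c.mul (isTranspose_w.mul isTranspose_w)).mul (isTranspose_e _ _ _ _))).add
    (isTranspose_w.mul (isTranspose_e _ _ _ _))).add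
    (isTranspose_E _ _)).add (isTranspose_E _ _)).add (isTranspose_E _ _)).add (isTranspose_E _ _))

theorem isTranspose_W1 : IsTranspose W1 W1T := by
  unfold W1 W1T
  refine ((((((((isTranspose_c'.mul isTranspose_w).mul
    (((isTranspose_e _ _ _ _).add (isTranspose_e _ _ _ _)).add (isTranspose_e _ _ _ _))).add
    (isTranspose_w.mul (isTranspose_e _ _ _ _))).add
    ((isTranspose_c.mul isTranspose_w).mul (isTranspose_e _ _ _ _))).add
    ((isTranspose_c.mul isTranspose_w).mul (isTranspose_e _ _ _ _))).add
    (isTranspose_E _ _)).add (isTranspose_E _ _)).add (isTranspose_E _ _))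

/-! ### The matrices of the right movers -/

def V0' : Op :=
  V0T - (E (0, 0, 0, 1) (1, 1, 1, 1) + E (0, 1, 0, 1) (1, 2, 1, 1) + E (0, 1, 0, 1) (1, 1, 1, 0))

def V1' : Op := V1T

def W0' : Op := W0T - (E (0, 0, 0, 1) (1, 1, 1, 1) + E (0, 0, 0, 1) (1, 2, 1, 1))

def W1' : Op :=
  W1T - (E (0, 0, 2, 1) (1, 1, 1, 1) + E (0, 0, 2, 1) (1, 1, 2, 1)
    + E (0, 1, 2, 1) (1, 2, 1, 1) + E (0, 1, 2, 1) (1, 2, 2, 1))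

/-! ### Boundary vectors and overlaps -/

/-- The vector of `⟨l(t)|`. -/
def lVec (t : ℕ) : Aux := ket 0 t 0 0

/-- `|r⟩`. -/
def rVec : Aux := ket 0 0 0 1 + ket 0 0 1 1 + ket 0 0 2 1

/-- The vector of `⟨l'|`. -/
def lVec' : Aux :=
  ket 0 0 0 1 + ket 0 0 1 1 + ket 0 0 2 1 + ket 0 1 0 1 + ket 0 1 2 1

/-- `|r'(t)⟩`. -/
def rVec' (t : ℕ) : Aux := ket 0 (t + 1) 0 0

/-- The contribution of the left movers. -/
def L (m t : ℕ) : ℝ :=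
  bracket (lVec t) ((((V0 + V1) * (W0 + W1)) ^ m * V0 * (W0 * V0) ^ (t - m)) rVec)

/-- The contribution of the right movers. -/
def R (m t : ℕ) : ℝ :=
  bracket lVec' ((((V0' + V1') * (W0' + W1')) ^ m * V0' * (W0' * V0') ^ (t - m)) (rVec' t))

/-- The density along the diagonal `m`. -/
def diagonalDensity (m t : ℕ) : ℝ := (2 : ℝ) ^ (-2 * (m : ℤ)) * (L m t + R m t)

/-! ### Notation of the closed expression -/

/-- Kronecker's delta. -/
def delta (i j : ℕ) : ℝ := if i = j then 1 else 0

/-- The discrete Heaviside function. -/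
def theta (x : ℤ) : ℝ := if 0 ≤ x then 1 else 0

/-- Binomial coefficients, zero when an entry is negative. -/
def binom (n k : ℤ) : ℝ := if 0 ≤ n ∧ 0 ≤ k then (n.toNat.choose k.toNat : ℝ) else 0

end Rule54

end

open Rule54

noncomputable section

namespace Rule54

/-! ### Averages over finite words -/

/-! The dynamics and the matrix product are reduced to the same two-index recursion, which the
closed expression also satisfies.

Dynamics. For fixed `k`, the sites `k - i` at times `i + 1 + k`, `i ≥ 0`, form the `k`-th
left-moving light ray. If `X` and `Y` are consecutive rays, the local rule reads `Y (i+1) = χ (X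
(i+1), X i, Y i)`, so one ray is obtained from the preceding one by a transducer (`transduce`). It
starts in the state `0, 0`, because almost surely nothing lies outside the light cone. The ray `k =
0` consists of fair independent letters (`wordAvg_rayOf`), and each application of the transducer
inserts one more `0`: in law, ray `k` is a fair sequence with a `0` inserted after each of its first
`k` ones (`gapAvg_transduce`). Conditioning on the first letter gives, for the density `r(k, m)` of
the letter `m + 1`, `r(k+1, m+2) = (r(k+1, m+1) + r(k, m)) / 2`, with `r(0, m) = r(k, 0) = 1/2` and
`r(k+1, 1) = 1/4`.

Matrix product. With `t = m + k`, both `L` and `R` satisfy `f(m+2, k+1) = 2 f(m+1, k+1) + 8 f(m, k)`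
(`DiagonalRec`), which is the recursion for `4^m r(k, m-1)`. A solution is fixed by its values at `m
= 0`, `m = 1` and `k = 0`, and there the two sides agree (`diagonalDensity_eq`). For `L`, the row
vector is evaluated on the basis vectors through the coefficients `leftCoeff`, whose symmetries
yield the recursion. For `R`, the matrices are transposed and the row vector has an explicit form as
a product of entries of two Pascal triangles (`rightCoeff`).

Closed expression. Its rows, shallow diagonals and Kronecker terms combine to satisfy the recursion
and the boundary values of `r` (`closedDensity_rec`). Sites with `x + t` even are reduced to the
preceding time step, at which they are not updated. -/

/-- The average of `F` over the words of length `n`. -/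
def wordAvg : ℕ → (List (Fin 2) → ℝ) → ℝ
  | 0, F => F []
  | n + 1, F => (wordAvg n (fun l => F (0 :: l)) + wordAvg n (fun l => F (1 :: l))) / 2

/-- The average over the words of length `n` that arise from fair letters when a `0` is inserted
after each of the first `k` letters `1`. -/
def gapAvg : ℕ → ℕ → (List (Fin 2) → ℝ) → ℝ
  | 0, n, F => wordAvg n F
  | _ + 1, 0, F => F []
  | _ + 1, 1, F => (F [0] + F [1]) / 2
  | k + 1, n + 2, F =>
      (gapAvg (k + 1) (n + 1) (fun l => F (0 :: l)) + gapAvg k n (fun l => F (1 :: 0 :: l))) / 2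

/-- One light ray as a function of the preceding one: `a` and `b` are the current letters of the
input ray and of the output ray. -/
def transduce : Fin 2 → Fin 2 → List (Fin 2) → List (Fin 2)
  | _, _, [] => []
  | a, b, x :: u => chi x a b :: transduce x (chi x a b) u

theorem wordAvg_congr {n : ℕ} {F G : List (Fin 2) → ℝ} (h : ∀ l, l.length = n → F l = G l) :
    wordAvg n F = wordAvg n G := by
  induction n generalizing F G with
  | zero => exact h [] rfl
  | succ n ih =>
    simp only [wordAvg]
    rw [ih fun l hl => h (0 :: l) (by simp [hl]), ih fun l hl => h (1 :: l) (by simp [hl])]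

theorem gapAvg_congr (k n : ℕ) {F G : List (Fin 2) → ℝ} (h : ∀ l, l.length = n → F l = G l) :
    gapAvg k n F = gapAvg k n G := by
  induction k, n, F using gapAvg.induct generalizing G with
  | case1 n F => simpa [gapAvg] using wordAvg_congr h
  | case2 k F => simpa [gapAvg] using h [] rfl
  | case3 k F => simp [gapAvg, h [0] rfl, h [1] rfl]
  | case4 k n F ih₁ ih₂ =>
    simp only [gapAvg]
    rw [ih₁ fun l hl => h (0 :: l) (by simp [hl]), ih₂ fun l hl => h (1 :: 0 :: l) (by simp [hl])]

theorem chi_table : (chi 0 0 0 = 0) ∧ (chi 1 0 0 = 1) ∧ (chi 0 0 1 = 1) ∧ (chi 1 0 1 = 1) ∧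
    (chi 0 1 0 = 1) ∧ (chi 1 1 0 = 0) ∧ (chi 0 1 1 = 0) ∧ (chi 1 1 1 = 0) := by decide

/-- A fair hidden letter makes the output ray fair. -/
theorem wordAvg_transduce (n : ℕ) (b : Fin 2) (G : List (Fin 2) → ℝ) :
    (wordAvg n (fun l => G (transduce 0 b l)) + wordAvg n (fun l => G (transduce 1 b l))) / 2
      = wordAvg n G := by
  induction n generalizing b G with
  | zero => simp [wordAvg, transduce]
  | succ n ih =>
    have h0 := ih 0 (fun l => G (0 :: l))
    have h1 := ih 1 (fun l => G (1 :: l))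
    obtain ⟨c1, c2, c3, c4, c5, c6, c7, c8⟩ := chi_table
    simp only [wordAvg, transduce]
    rw [← h0, ← h1]
    -- The output letter is `x + a` for `b = 0` and `1 + a` for `b = 1`. With `a` and `x` fair it is
    -- fair, and given its value the next hidden letter `x` is still fair, so the induction
    -- hypothesis applies again.
    fin_cases b <;> simp [c1, c2, c3, c4, c5, c6, c7, c8] <;> ring

/-- From the state `0, 0` the transducer copies its input up to and including the first `1`. The
following output letter is `0` whatever is read, so the letter read becomes a fair hidden letter,
and by `wordAvg_transduce` the rest of the output is fair. -/
theorem gapAvg_one (n : ℕ) (F : List (Fin 2) → ℝ) :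
    wordAvg n (fun l => F (transduce 0 0 l)) = gapAvg 1 n F := by
  obtain ⟨c1, c2, c3, c4, c5, c6, c7, c8⟩ := chi_table
  induction n using Nat.strong_induction_on generalizing F with
  | _ n ih =>
    match n with
    | 0 => simp [wordAvg, gapAvg, transduce]
    | 1 => simp [wordAvg, gapAvg, transduce, c1, c2]
    | n + 2 =>
      rw [wordAvg, gapAvg, gapAvg]
      simp only [transduce, c1, c2]
      rw [ih (n + 1) (by omega) (fun l => F (0 :: l))]
      have := wordAvg_transduce n 0 (fun l => F (1 :: 0 :: l))
      rw [← this]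
      simp [wordAvg, transduce, c7, c8]

/-- A light ray with `k` inserted letters is followed by one with `k + 1` inserted letters. -/
theorem gapAvg_transduce (k n : ℕ) (F : List (Fin 2) → ℝ) :
    gapAvg k n (fun l => F (transduce 0 0 l)) = gapAvg (k + 1) n F := by
  obtain ⟨c1, c2, c3, c4, c5, c6, c7, c8⟩ := chi_table
  induction k generalizing n F with
  | zero => rw [gapAvg, gapAvg_one]
  | succ k ihk =>
    induction n using Nat.strong_induction_on generalizing F with
    | _ n ih =>
      match n with
      | 0 => simp [gapAvg, transduce]
      | 1 => simp [gapAvg, transduce, c1, c2]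
      | n + 2 =>
        rw [gapAvg, gapAvg]
        simp only [transduce, c1, c2, c7]
        -- A block `1 0` of the input is copied and returns the transducer to the state `0, 0`.
        -- Existing gaps therefore survive, and the first `1` after the last of them receives the
        -- new gap, as in `gapAvg_one`.
        rw [ih (n + 1) (by omega) (fun l => F (0 :: l)), ihk n (fun l => F (1 :: 0 :: l))]

theorem gapAvg_iterate (k n : ℕ) (F : List (Fin 2) → ℝ) :
    wordAvg n (fun l => F ((transduce 0 0)^[k] l)) = gapAvg k n F := by
  induction k generalizing F with
  | zero => simp [gapAvg]
  | succ k ih =>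
    rw [← gapAvg_transduce, ← ih]
    simp only [Function.iterate_succ_apply']

/-- The light ray that issues from a letter `b` and the letters to its left. -/
def rayOf : Fin 2 → List (Fin 2) → List (Fin 2)
  | b, a :: x :: u => transduce a b (x :: rayOf x u)
  | _, _ => []

/-- In `transduce a b (x :: rayOf x u)` the tail is fair for either value of `x` by induction, so
the whole input is fair. The letter `a` plays the part of the fair hidden letter. -/
theorem wordAvg_rayOf (n : ℕ) (b : Fin 2) (F : List (Fin 2) → ℝ) :
    wordAvg (2 * n) (fun l => F (rayOf b l)) = wordAvg n F := by
  induction n generalizing b F with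
  | zero => simp [wordAvg, rayOf]
  | succ n ih =>
    rw [← wordAvg_transduce (n + 1) b F, show 2 * (n + 1) = 2 * n + 1 + 1 by ring]
    simp only [wordAvg, rayOf]
    rw [ih 0 (fun l => F (transduce 0 b (0 :: l))), ih 1 (fun l => F (transduce 0 b (1 :: l))),
      ih 0 (fun l => F (transduce 1 b (0 :: l))), ih 1 (fun l => F (transduce 1 b (1 :: l)))]

/-! ### The density along a ray -/

/-- The indicator function of the words that end in `1`. -/
def endsInOne (l : List (Fin 2)) : ℝ := if l.getLast? = some 1 then 1 else 0

theorem endsInOne_cons (a : Fin 2) {l : List (Fin 2)} (h : l ≠ []) :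
    endsInOne (a :: l) = endsInOne l := by
  obtain ⟨b, u, rfl⟩ := List.exists_cons_of_ne_nil h
  simp [endsInOne, List.getLast?_cons_cons]

theorem wordAvg_endsInOne (n : ℕ) : wordAvg (n + 1) endsInOne = 1 / 2 := by
  induction n with
  | zero => simp [wordAvg, endsInOne]
  | succ n ih =>
    rw [wordAvg]
    have h : ∀ a, wordAvg (n + 1) (fun l => endsInOne (a :: l)) = 1 / 2 := fun a => by
      rw [← ih]
      exact wordAvg_congr fun l hl => endsInOne_cons a (by rintro rfl; simp at hl)
    rw [h, h]; norm_num

/-- The probability that the site `m + 1` of the `k`-th light ray is occupied. -/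
def rayDensity (k m : ℕ) : ℝ := gapAvg k (m + 1) endsInOne

theorem rayDensity_zero_left (m : ℕ) : rayDensity 0 m = 1 / 2 := by
  rw [rayDensity, gapAvg, wordAvg_endsInOne]

theorem rayDensity_succ_zero (k : ℕ) : rayDensity (k + 1) 0 = 1 / 2 := by
  simp [rayDensity, gapAvg, endsInOne]

theorem rayDensity_zero_right (k : ℕ) : rayDensity k 0 = 1 / 2 := by
  cases k
  · exact rayDensity_zero_left 0
  · exact rayDensity_succ_zero _

theorem rayDensity_succ_one (k : ℕ) : rayDensity (k + 1) 1 = 1 / 4 := by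
  cases k <;> simp [rayDensity, gapAvg, endsInOne, wordAvg] <;> norm_num

/-- Conditioning on the first letter: a `0` uses up one letter and no gap, while a `1` comes with
its inserted `0` and uses up two letters and one gap. -/
theorem rayDensity_succ (k m : ℕ) :
    rayDensity (k + 1) (m + 2) = (rayDensity (k + 1) (m + 1) + rayDensity k m) / 2 := by
  rw [rayDensity, gapAvg, rayDensity, rayDensity]
  have h₁ : gapAvg (k + 1) (m + 1 + 1) (fun l => endsInOne (0 :: l))
      = gapAvg (k + 1) (m + 1 + 1) endsInOne :=
    gapAvg_congr _ _ fun l hl => endsInOne_cons 0 (by rintro rfl; simp at hl)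
  have h₂ : gapAvg k (m + 1) (fun l => endsInOne (1 :: 0 :: l)) = gapAvg k (m + 1) endsInOne :=
    gapAvg_congr _ _ fun l hl => by
      rw [endsInOne_cons 1 (by simp), endsInOne_cons 0 (by rintro rfl; simp at hl)]
  rw [h₁, h₂]

/-! ### The light rays of the automaton -/

/-- The word of the first `n` letters of a sequence. -/
def prefixWord : (ℕ → Fin 2) → ℕ → List (Fin 2)
  | _, 0 => []
  | X, n + 1 => X 0 :: prefixWord (fun i => X (i + 1)) n

theorem getLast?_prefixWord (X : ℕ → Fin 2) (n : ℕ) :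
    (prefixWord X (n + 1)).getLast? = some (X n) := by
  induction n generalizing X with
  | zero => rfl
  | succ n ih => rw [prefixWord, prefixWord, List.getLast?_cons_cons]; exact ih fun i => X (i + 1)

theorem transduce_prefixWord {X Y : ℕ → Fin 2}
    (h : ∀ i, Y (i + 1) = chi (X (i + 1)) (X i) (Y i)) (n : ℕ) :
    transduce (X 0) (Y 0) (prefixWord (fun i => X (i + 1)) n)
      = prefixWord (fun i => Y (i + 1)) n := by
  induction n generalizing X Y with
  | zero => rfl
  | succ n ih =>
    simp only [prefixWord, transduce]
    rw [← h 0]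
    simpa using ih (X := fun i => X (i + 1)) (Y := fun i => Y (i + 1)) fun i => h (i + 1)

theorem evolve_even (s : Config) (t : ℕ) (x : ℤ) (h : (x + t) % 2 = 0) :
    evolve (t + 1) s x
      = chi (evolve t s (x - 1)) (evolve t s x) (evolve t s (x + 1)) := by
  rw [evolve]
  split_ifs with ht
  · rw [evenStep, if_pos (by omega)]
  · rw [oddStep, if_neg (by omega)]

theorem evolve_odd (s : Config) (t : ℕ) (x : ℤ) (h : (x + t) % 2 = 1) :
    evolve (t + 1) s x = evolve t s x := by
  rw [evolve]
  split_ifs with ht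
  · rw [evenStep, if_neg (by omega)]
  · rw [oddStep, if_pos (by omega)]

/-- The ray of the light cone of an odd site is determined by the letters to its left. -/
theorem rayOf_config (s : Config) (n : ℕ) (q : ℤ) (hq : q % 2 = 1) :
    rayOf (s q) (prefixWord (fun i => s (q - 1 - i)) (2 * n))
      = prefixWord (fun i => evolve (i + 1) s (q - i - 1)) n := by
  induction n generalizing q with
  | zero => rfl
  | succ n ih =>
    have key := transduce_prefixWord
      -- The input is the ray of `q - 2`, preceded by `s (q - 1)`. The centre `q - 1 - i` of the
      -- local rule at time `i` has not changed since time `i - 1`, when it belonged to that ray; at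
      -- `i = 0` there is no earlier time and the initial letter itself is read.
      (X := fun i => match i with
        | 0 => s (q - 1)
        | i + 1 => evolve i s (q - 2 - i))
      (Y := fun i => evolve i s (q - i)) ?_ (n + 1)
    · rw [show 2 * (n + 1) = 2 * n + 1 + 1 by ring]
      simp only [prefixWord, rayOf]
      have ih' := ih (q - 2) (by omega)
      have e1 : (fun i : ℕ => s (q - 2 - 1 - i))
          = fun i : ℕ => s (q - 1 - ((i + 1 + 1 : ℕ) : ℤ)) := by
        funext i; congr 1; push_cast; ring
      rw [e1] at ih'
      have e2 : q - 1 - ((0 + 1 : ℕ) : ℤ) = q - 2 := by push_cast; ring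
      rw [e2, ih']
      simp only [prefixWord, show ∀ x, evolve 0 s x = s x from fun _ => rfl] at key
      have e3 : (fun i : ℕ => evolve (i + 1) s (q - 2 - i - 1))
          = fun i : ℕ => evolve (i + 1) s (q - 2 - ((i + 1 : ℕ) : ℤ)) := by
        funext i; congr 1; push_cast; ring
      rw [e3]
      have e4 : q - 1 - ((0 : ℕ) : ℤ) = q - 1 := by simp
      have e5 : q - 2 - ((0 : ℕ) : ℤ) = q - 2 := by simp
      have e6 : q - ((0 : ℕ) : ℤ) = q := by simp
      rw [e5, e6] at key
      rw [e4, key]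
      congr 1
      · congr 1; push_cast; ring
      · congr 1; funext i; congr 1; push_cast; ring
    · intro i
      have e : evolve (i + 1) s (q - ((i + 1 : ℕ) : ℤ))
          = chi (evolve i s (q - 2 - i)) (evolve i s (q - 1 - i)) (evolve i s (q - i)) := by
        rw [evolve_even _ _ _ (by push_cast; omega)]
        congr 2 <;> push_cast <;> ring
      cases i with
      | zero => simpa [evolve] using e
      | succ i =>
        simp only at e ⊢
        rw [e, evolve_odd s i (q - 1 - ((i + 1 : ℕ) : ℤ)) (by push_cast; omega)]
        congr 2
        push_cast; ring

theorem evolve_eq_zero {s : Config} (hs : ∀ x : ℤ, 0 < x → s x = 0) (t : ℕ) (x : ℤ)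
    (hx : 0 < x) (ht : (t : ℤ) ≤ x) : evolve t s x = 0 := by
  induction t generalizing x with
  | zero => exact hs x hx
  | succ t ih =>
    push_cast at ht
    rcases Int.emod_two_eq_zero_or_one (x + t) with h | h
    · rw [evolve_even s t x h, ih x (by omega) (by omega), ih (x + 1) (by omega) (by omega),
        ih (x - 1) (by omega) (by omega)]
      rfl
    · rw [evolve_odd s t x h, ih x hx (by omega)]

/-- Each ray is prolonged by one site to the upper right, which lies outside the light cone of the
occupied half and is empty. Hence the transducer always starts in the state `0, 0`. -/
theorem iterate_transduce_config {s : Config} (hs : ∀ x : ℤ, 0 < x → s x = 0) (k n : ℕ) :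
    (transduce 0 0)^[k] (rayOf 0 (prefixWord (fun i => s (0 - i)) (2 * n)))
      = prefixWord (fun i => evolve (i + 1 + k) s (k - i)) n := by
  induction k with
  | zero =>
    have h := rayOf_config s n 1 rfl
    rw [hs 1 one_pos] at h
    simp only [sub_self] at h
    rw [Function.iterate_zero, id, h]
    congr 1; funext i; congr 1; push_cast; ring
  | succ k ih =>
    rw [Function.iterate_succ_apply', ih]
    have key := transduce_prefixWord
      (X := fun i => evolve (i + k) s (k + 1 - i))
      (Y := fun i => evolve (i + (k + 1)) s (k + 2 - i)) ?_ n
    · have h1 : evolve (0 + k) s (k + 1 - (0 : ℕ)) = 0 :=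
        evolve_eq_zero hs _ _ (by push_cast; omega) (by push_cast; omega)
      have h2 : evolve (0 + (k + 1)) s (k + 2 - (0 : ℕ)) = 0 :=
        evolve_eq_zero hs _ _ (by push_cast; omega) (by push_cast; omega)
      simp only [h1, h2] at key
      convert key using 3
      · funext i; congr 1; push_cast; ring
      · congr 1; push_cast; ring
    · intro i
      have e := evolve_even s (i + k + 1) (k + 1 - i) (by push_cast; omega)
      rw [evolve_odd s (i + k) (k + 1 - i) (by push_cast; omega)] at e
      rw [show i + 1 + (k + 1) = i + k + 1 + 1 by ring, show i + 1 + k = i + k + 1 by ring,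
        show i + (k + 1) = i + k + 1 by ring]
      push_cast
      rw [show (k : ℤ) + 2 - (i + 1) = k + 1 - i by ring, e]
      congr 2 <;> ring

/-! ### The initial state -/

instance : IsProbabilityMeasure initialState := by
  unfold initialState; infer_instance

theorem siteLaw_singleton {x : ℤ} (hx : x ≤ 0) (a : Fin 2) : siteLaw x {a} = 2⁻¹ := by
  rw [siteLaw, if_pos hx]
  fin_cases a <;> simp [Set.indicator]

theorem initialState_cylinder (I : Finset ℤ) (hI : ∀ x ∈ I, x ≤ 0) (a : ℤ → Fin 2) :
    initialState.real {s | ∀ x ∈ I, s x = a x} = (1 / 2) ^ I.card := by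
  have h : {s : Config | ∀ x ∈ I, s x = a x} = Set.pi I fun x => {a x} := by
    ext s; simp [Set.mem_pi]
  rw [h, measureReal_def, initialState, Measure.infinitePi_pi _ (fun _ _ => MeasurableSet.of_discrete),
    Finset.prod_congr rfl fun x hx => siteLaw_singleton (hI x hx) (a x)]
  simp

theorem initialState_pos : ∀ᵐ s ∂initialState, ∀ x : ℤ, 0 < x → s x = 0 := by
  rw [ae_all_iff]
  intro x
  by_cases hx : 0 < x
  · have h : Measure.map (fun s : Config => s x) initialState = Measure.dirac 0 := by
      rw [initialState, Measure.infinitePi_map_eval, siteLaw, if_neg (by omega)]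
    have h2 : ∀ᵐ y ∂(Measure.map (fun s : Config => s x) initialState), y = 0 := by
      rw [h]; simp [ae_dirac_eq]
    have := ae_of_ae_map (measurable_pi_apply x).aemeasurable h2
    filter_upwards [this] with s hs _ using hs
  · exact Filter.Eventually.of_forall fun s h => absurd h hx

/-- Fixing the `j` letters already read makes an induction on the length of the unread word
possible: splitting on the next letter turns it into one more fixed letter. -/
theorem measureReal_cylinder_word (n j : ℕ) (p : ℤ) (hp : p ≤ 0) (a : ℤ → Fin 2)
    (P : List (Fin 2) → Prop) [DecidablePred P] :
    initialState.real {s | (∀ x ∈ Finset.Ioc (p - j) p, s x = a x)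
        ∧ P (prefixWord (fun i => s (p - j - i)) n)}
      = (1 / 2) ^ j * wordAvg n (fun l => if P l then 1 else 0) := by
  induction n generalizing j a P with
  | zero =>
    by_cases h : P []
    · simp only [prefixWord, wordAvg, h, and_true, if_true, mul_one]
      rw [initialState_cylinder _ (fun x hx => by rw [Finset.mem_Ioc] at hx; omega)]
      simp
    · simp [prefixWord, wordAvg, h]
  | succ n ih =>
    have hm : MeasurableSet {s : Config | s (p - j) = 0} :=
      measurable_pi_apply (p - (j : ℤ)) (MeasurableSet.of_discrete (s := {0}))
    have key : ∀ b : Fin 2, initialState.real {s | ((∀ x ∈ Finset.Ioc (p - j) p, s x = a x)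
        ∧ P (prefixWord (fun i => s (p - j - i)) (n + 1))) ∧ s (p - j) = b}
        = (1 / 2) ^ (j + 1) * wordAvg n (fun l => if P (b :: l) then 1 else 0) := by
      intro b
      rw [← ih (j + 1) (Function.update a (p - j) b) (fun l => P (b :: l))]
      congr 1
      ext s
      have e : (fun i : ℕ => s (p - j - ((i + 1 : ℕ) : ℤ)))
          = fun i : ℕ => s (p - ((j + 1 : ℕ) : ℤ) - i) := by
        funext i; congr 1; push_cast; ring
      have e0 : p - (j : ℤ) - ((0 : ℕ) : ℤ) = p - j := by simp
      simp only [Set.mem_ofPred_eq, prefixWord, e, e0, Finset.mem_Ioc]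
      constructor
      · rintro ⟨⟨h1, h2⟩, h3⟩
        refine ⟨fun x hx => ?_, h3 ▸ h2⟩
        by_cases hxj : x = p - j
        · subst hxj; simpa using h3
        · rw [Function.update_of_ne hxj]
          exact h1 x ⟨by push_cast at hx; omega, hx.2⟩
      · rintro ⟨h1, h2⟩
        have h3 : s (p - j) = b := by
          simpa using h1 (p - j) ⟨by push_cast; omega, by omega⟩
        refine ⟨⟨fun x hx => ?_, h3 ▸ h2⟩, h3⟩
        have := h1 x ⟨by push_cast; omega, hx.2⟩
        rwa [Function.update_of_ne (by omega)] at this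
    rw [← measureReal_inter_add_sdiff hm, wordAvg]
    have k0 := key 0
    have k1 := key 1
    have s0 : ∀ Q : Set Config, Q ∩ {s | s (p - j) = 0} = {s | s ∈ Q ∧ s (p - j) = 0} :=
      fun Q => rfl
    have s1 : ∀ Q : Set Config, Q \ {s | s (p - j) = 0} = {s | s ∈ Q ∧ s (p - j) = 1} := by
      intro Q; ext s
      simp only [Set.mem_sdiff, Set.mem_ofPred_eq]
      refine and_congr_right fun _ => ?_
      have : ∀ b : Fin 2, ¬ b = 0 ↔ b = 1 := by decide
      exact this _
    rw [s0, s1]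
    simp only [Set.mem_ofPred_eq]
    rw [k0, k1]
    ring

theorem measureReal_word (n : ℕ) (p : ℤ) (hp : p ≤ 0) (P : List (Fin 2) → Prop)
    [DecidablePred P] :
    initialState.real {s | P (prefixWord (fun i => s (p - i)) n)}
      = wordAvg n (fun l => if P l then 1 else 0) := by
  have := measureReal_cylinder_word n 0 p hp 0 P
  simpa using this

/-! ### The density profile -/

theorem densityProfile_of_odd (k m : ℕ) :
    densityProfile (k - m) (m + 1 + k) = rayDensity k m := by
  have h := measureReal_word (2 * (m + 1)) 0 le_rfl
    (fun l => ((transduce 0 0)^[k] (rayOf 0 l)).getLast? = some 1)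
  have e1 : initialState.real {s | evolve (m + 1 + k) s (k - m) = 1}
      = initialState.real {s | ((transduce 0 0)^[k] (rayOf 0
        (prefixWord (fun i => s (0 - i)) (2 * (m + 1))))).getLast? = some 1} := by
    refine measureReal_congr ?_
    filter_upwards [initialState_pos] with s hs
    refine propext ?_
    change evolve (m + 1 + k) s (k - m) = 1 ↔ _ = some 1
    rw [iterate_transduce_config hs, getLast?_prefixWord]
    simp
  rw [densityProfile, e1, h, rayDensity, ← gapAvg_iterate, ← wordAvg_rayOf (m + 1) 0]
  rfl

theorem densityProfile_of_even (x : ℤ) (t : ℕ) (h : (x + t) % 2 = 1) :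
    densityProfile x (t + 1) = densityProfile x t := by
  simp only [densityProfile, evolve_odd _ t x h]

theorem densityProfile_left_of_odd (x : ℤ) (t : ℕ) (h : (x + t) % 2 = 1) (hx : x ≤ -t) :
    densityProfile x t = 1 / 2 := by
  cases t with
  | zero =>
    have := measureReal_word 1 x (by simpa using hx) (fun l => l.getLast? = some 1)
    simp only [prefixWord, wordAvg] at this
    simpa [densityProfile, evolve] using this
  | succ n =>
    push_cast at h hx
    have key : ∀ b : Fin 2, ∀ s : Config, s (x + (n + 1)) = b → (evolve (n + 1) s x = 1 ↔
        (rayOf b (prefixWord (fun i => s (x + n - i)) (2 * (n + 1)))).getLast? = some 1) := by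
      intro b s hb
      have := rayOf_config s (n + 1) (x + (n + 1)) (by omega)
      rw [hb, show (fun i : ℕ => s (x + (n + 1) - 1 - i)) = fun i : ℕ => s (x + n - i) by
        funext i; congr 1; ring] at this
      rw [this, getLast?_prefixWord, show x + ((n : ℤ) + 1) - n - 1 = x by ring]
      simp
    have h2 := measureReal_word (2 * (n + 1) + 1) (x + (n + 1)) (by omega)
      (fun l => (rayOf (l.headD 0) l.tail).getLast? = some 1)
    rw [densityProfile]
    have e : {s | evolve (n + 1) s x = 1} = {s : Config | (rayOf
        ((prefixWord (fun i => s (x + (n + 1) - i)) (2 * (n + 1) + 1)).headD 0)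
        (prefixWord (fun i => s (x + (n + 1) - i)) (2 * (n + 1) + 1)).tail).getLast? = some 1} := by
      ext s
      simp only [Set.mem_ofPred_eq]
      rw [key _ s rfl, prefixWord]
      simp only [List.headD_cons, List.tail_cons]
      rw [show (fun i : ℕ => s (x + (n + 1) - ((i + 1 : ℕ) : ℤ))) = fun i : ℕ => s (x + n - i) by
        funext i; congr 1; push_cast; ring, show x + ((n : ℤ) + 1) - ((0 : ℕ) : ℤ) = x + (n + 1) by
        simp]
    rw [e, h2, wordAvg]
    -- To the left of the light cone the first letter `b` of the ray is random rather than `0`, but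
    -- the ray is fair for either value of it.
    have w : ∀ b : Fin 2, wordAvg (2 * (n + 1))
        (fun l => if (rayOf b l).getLast? = some 1 then (1 : ℝ) else 0) = 1 / 2 := fun b => by
      rw [← wordAvg_endsInOne n, ← wordAvg_rayOf (n + 1) b]
      rfl
    exact (congrArg₂ (fun a b : ℝ => (a + b) / 2) (w 0) (w 1)).trans (by norm_num)

theorem densityProfile_left (x : ℤ) (t : ℕ) (hx : x ≤ -t) : densityProfile x t = 1 / 2 := by
  rcases Int.emod_two_eq_zero_or_one (x + t) with h | h
  · cases t with
    | zero =>
      have := measureReal_word 1 x (by simpa using hx) (fun l => l.getLast? = some 1)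
      simp only [prefixWord, wordAvg] at this
      simpa [densityProfile, evolve] using this
    | succ t =>
      push_cast at h hx
      rw [densityProfile_of_even x t (by omega)]
      exact densityProfile_left_of_odd x t (by omega) (by omega)
  · exact densityProfile_left_of_odd x t h hx

theorem densityProfile_right (x : ℤ) (t : ℕ) (h : 1 ≤ t ∨ 1 ≤ x) (hx : (t : ℤ) ≤ x) :
    densityProfile x t = 0 := by
  have : initialState.real {s | evolve t s x = 1} = initialState.real (∅ : Set Config) := by
    refine measureReal_congr ?_
    filter_upwards [initialState_pos] with s hs
    refine propext ?_
    change evolve t s x = 1 ↔ False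
    rw [evolve_eq_zero hs t x (by omega) hx]
    simp
  rw [densityProfile, this, measureReal_empty]

/-! ### Action of the operators on the basis vectors -/

theorem opOf_ket (f : Label → Aux) (c w : ℕ) (n : Fin 3) (a : Fin 2) :
    opOf f (ket c w n a) = f (c, w, n, a) := by
  simp [opOf, ket]

theorem cUp_ket (c w : ℕ) (n : Fin 3) (a : Fin 2) : cUp (ket c w n a) = ket (c + 1) w n a :=
  opOf_ket _ _ _ _ _

theorem wUp_ket (c w : ℕ) (n : Fin 3) (a : Fin 2) : wUp (ket c w n a) = ket c (w + 1) n a :=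
  opOf_ket _ _ _ _ _

theorem cDown_ket_succ (c w : ℕ) (n : Fin 3) (a : Fin 2) :
    cDown (ket (c + 1) w n a) = ket c w n a := by simp [cDown, opOf_ket]

theorem cDown_ket_zero (w : ℕ) (n : Fin 3) (a : Fin 2) : cDown (ket 0 w n a) = 0 := by
  simp [cDown, opOf_ket]

theorem wDown_ket_succ (c w : ℕ) (n : Fin 3) (a : Fin 2) :
    wDown (ket c (w + 1) n a) = ket c w n a := by simp [wDown, opOf_ket]

theorem wDown_ket_zero (c : ℕ) (n : Fin 3) (a : Fin 2) : wDown (ket c 0 n a) = 0 := by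
  simp [wDown, opOf_ket]

theorem e_ket (n₂ : Fin 3) (a₂ : Fin 2) (n₁ : Fin 3) (a₁ : Fin 2) (c w : ℕ) (n : Fin 3)
    (a : Fin 2) : e n₂ a₂ n₁ a₁ (ket c w n a) = if n = n₁ ∧ a = a₁ then ket c w n₂ a₂ else 0 :=
  opOf_ket _ _ _ _ _

theorem E_ket (c₂ w₂ : ℕ) (n₂ : Fin 3) (a₂ : Fin 2) (c₁ w₁ : ℕ) (n₁ : Fin 3) (a₁ : Fin 2)
    (c w : ℕ) (n : Fin 3) (a : Fin 2) :
    E (c₂, w₂, n₂, a₂) (c₁, w₁, n₁, a₁) (ket c w n a)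
      = if c = c₁ ∧ w = w₁ ∧ n = n₁ ∧ a = a₁ then ket c₂ w₂ n₂ a₂ else 0 := by
  rw [E, opOf_ket]; simp [ket]

theorem bracket_ket (c w : ℕ) (n : Fin 3) (a : Fin 2) (v : Aux) :
    bracket (ket c w n a) v = v (c, w, n, a) := by
  simp [bracket, ket]

theorem V_ket_zero_zero (c w : ℕ) :
    (V0 + V1) (ket c w 0 0) = ket c w 0 0 + ket c w 1 0 + ket c w 2 0 := by
  simp [V0, V1, e_ket, E_ket]

theorem V_ket_one_zero (c w : ℕ) : (V0 + V1) (ket c w 1 0) = ket c w 0 0 := by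
  simp [V0, V1, e_ket, E_ket]

theorem V_ket_two_zero (c w : ℕ) : (V0 + V1) (ket c w 2 0) = ket c w 1 0 + ket c w 2 0 := by
  simp [V0, V1, e_ket, E_ket]

theorem V_ket_zero_one (c w : ℕ) :
    (V0 + V1) (ket c (w + 1) 0 1)
      = ket (c + 1) (w + 1) 1 0 + ket c (w + 1) 0 1 + ket (c + 1) (w + 2) 1 1
        + ket c (w + 1) 2 1 := by
  simp [V0, V1, e_ket, E_ket, cUp_ket, wUp_ket, wDown_ket_succ]

theorem V_ket_one_one (c w : ℕ) : (V0 + V1) (ket c (w + 1) 1 1) = ket c (w + 1) 0 1 := by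
  simp [V0, V1, e_ket, E_ket, wUp_ket, wDown_ket_succ]

theorem V_ket_two_one (c w : ℕ) :
    (V0 + V1) (ket c (w + 1) 2 1)
      = ket c (w + 1) 1 0 + ket c (w + 1) 2 0 + ket c (w + 2) 1 1 + ket c (w + 2) 2 1 := by
  simp [V0, V1, e_ket, E_ket, wUp_ket]

theorem W_ket_zero (w : ℕ) (n : Fin 3) : (W0 + W1) (ket 0 w n 0) = 0 := by
  fin_cases n <;> simp [W0, W1, e_ket, E_ket, wUp_ket, cDown_ket_zero]

theorem W_ket_zero_zero (c w : ℕ) :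
    (W0 + W1) (ket (c + 1) w 0 0) = ket c (w + 1) 0 0 + ket c (w + 1) 1 0 + ket c (w + 1) 2 0 := by
  simp [W0, W1, e_ket, E_ket, wUp_ket, cDown_ket_succ]

theorem W_ket_one_zero (c w : ℕ) : (W0 + W1) (ket (c + 1) w 1 0) = ket c (w + 1) 0 0 := by
  simp [W0, W1, e_ket, E_ket, wUp_ket, cDown_ket_succ]

theorem W_ket_two_zero (c w : ℕ) :
    (W0 + W1) (ket (c + 1) w 2 0) = ket c (w + 1) 1 0 + ket c (w + 1) 2 0 := by
  simp [W0, W1, e_ket, E_ket, wUp_ket, cDown_ket_succ]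

theorem W_ket_zero_one (c w : ℕ) :
    (W0 + W1) (ket c (w + 1) 0 1)
      = ket c (w + 2) 1 0 + ket c (w + 2) 0 1 + ket (c + 1) (w + 3) 1 1 + ket c (w + 2) 2 1 := by
  simp [W0, W1, e_ket, E_ket, wUp_ket, cUp_ket, pow_two]

theorem W_ket_one_one (c w : ℕ) : (W0 + W1) (ket c (w + 1) 1 1) = ket c (w + 2) 0 1 := by
  simp [W0, W1, e_ket, E_ket, wUp_ket]

theorem W_ket_two_one (c w : ℕ) :
    (W0 + W1) (ket c (w + 1) 2 1) = ket (c + 1) (w + 2) 1 1 + ket (c + 1) (w + 2) 2 1 := by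
  simp [W0, W1, e_ket, E_ket, wUp_ket, cUp_ket]

/-! ### The left movers -/

/-- The functional `⟨l(t)|((V₀ + V₁)(W₀ + W₁))^m`. -/
def leftFunctional (m t : ℕ) : Aux →ₗ[ℝ] ℝ :=
  Finsupp.lapply (0, t, 0, 0) ∘ₗ (((V0 + V1) * (W0 + W1)) ^ m : Op)

theorem leftFunctional_zero (t : ℕ) (v : Aux) : leftFunctional 0 t v = v (0, t, 0, 0) := by
  simp [leftFunctional]

theorem leftFunctional_succ (m t : ℕ) (v : Aux) :
    leftFunctional (m + 1) t v = leftFunctional m t ((V0 + V1) ((W0 + W1) v)) := by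
  simp [leftFunctional, pow_succ]

/-- The number of ways to continue after the soliton has been selected. -/
def freeWeight : ℕ → Fin 3 → ℝ
  | 0, n => if n = 0 then 1 else 0
  | m + 1, n => if n = 0 then 2 * 4 ^ m else 4 ^ m

/-- In the sector `a = 0` every period lowers `c` and raises `w` by one, so a single pair `(c, w)`
reaches `⟨0, t, 0, 0|`. What remains is to count paths in the label `n`. -/
theorem leftFunctional_ket_zero (m t c w : ℕ) (n : Fin 3) :
    leftFunctional m t (ket c w n 0) = if c = m ∧ w + m = t then freeWeight m n else 0 := by
  induction m generalizing c w n with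
  | zero =>
    rw [leftFunctional_zero]
    simp only [ket, Finsupp.single_apply, freeWeight, Prod.mk.injEq]
    split_ifs <;> simp_all
  | succ m ih =>
    rw [leftFunctional_succ]
    rcases c with _ | c
    · rw [W_ket_zero]; simp
    · have h : (c + 1 = m + 1 ∧ w + (m + 1) = t) ↔ (c = m ∧ w + 1 + m = t) := by omega
      simp only [h]
      fin_cases n
      · simp only [Fin.zero_eta, W_ket_zero_zero, map_add, V_ket_zero_zero, V_ket_one_zero,
          V_ket_two_zero, ih]
        split_ifs
        · cases m <;> simp [freeWeight] <;> ring
        · simp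
      · simp only [Fin.mk_one, W_ket_one_zero, map_add, V_ket_zero_zero, ih]
        split_ifs
        · cases m <;> simp [freeWeight]; ring
        · simp
      · simp only [Fin.reduceFinMk, W_ket_two_zero, map_add, V_ket_one_zero, V_ket_two_zero, ih]
        split_ifs
        · cases m <;> simp [freeWeight]; ring
        · simp

/-- The coefficients of the left functional in the sector before the selection of a soliton. -/
def leftCoeff : ℕ → ℕ → ℕ → ℕ → ℝ
  | 0, _, _, _ => 0
  | m + 1, t, c, w => 2 * leftCoeff m t c (w + 1) + 2 * leftCoeff m t (c + 1) (w + 2)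
      + if c = m ∧ m + 1 + w = t then 4 ^ m else 0

/-- This second relation, at fixed `m`, is what allows all three labels `n` to be expressed through
the one family `leftCoeff`: it closes the induction in `leftFunctional_ket_one`. -/
theorem leftCoeff_eq (m t c w : ℕ) :
    leftCoeff m t c w = (leftCoeff m t (c + 1) w + leftCoeff m t (c + 2) (w + 1)) / 2
      + if c + 1 = m ∧ m + w = t then 4 ^ c else 0 := by
  induction m generalizing c w with
  | zero => simp [leftCoeff]
  | succ m ih =>
    simp only [leftCoeff]
    rw [ih c (w + 1), ih (c + 1) (w + 2)]
    have h1 : (c + 1 = m ∧ m + (w + 1) = t) ↔ (c + 1 = m ∧ m + 1 + w = t) := by omega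
    have h2 : (c + 1 + 1 = m ∧ m + (w + 2) = t) ↔ (c + 2 = m ∧ m + 1 + (w + 1) = t) := by omega
    have h3 : (c + 1 = m + 1 ∧ m + 1 + w = t) ↔ (c = m ∧ m + 1 + w = t) := by omega
    simp only [h1, h2, h3]
    have e1 : (if c + 1 = m ∧ m + 1 + w = t then (4 : ℝ) ^ m else 0)
        = 4 * if c + 1 = m ∧ m + 1 + w = t then (4 : ℝ) ^ c else 0 := by
      split_ifs with h
      · rw [← h.1]; ring
      · simp
    have e2 : (if c + 2 = m ∧ m + 1 + (w + 1) = t then (4 : ℝ) ^ m else 0)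
        = 4 * if c + 2 = m ∧ m + 1 + (w + 1) = t then (4 : ℝ) ^ (c + 1) else 0 := by
      split_ifs with h
      · rw [← h.1]; ring
      · simp
    have e3 : (if c = m ∧ m + 1 + w = t then (4 : ℝ) ^ m else 0)
        = if c = m ∧ m + 1 + w = t then (4 : ℝ) ^ c else 0 := by
      split_ifs with h
      · rw [← h.1]
      · simp
    rw [e1, e2, e3]
    ring

/-- Only `w ≥ 1` is covered. There the projector in `V0` and `V1` acts as the identity, the
exceptional terms `E` vanish, and the set of such vectors is preserved as long as `a = 1`. -/
theorem leftFunctional_ket_one (m t c w : ℕ) :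
    leftFunctional m t (ket c (w + 1) 0 1) = leftCoeff m t c (w + 1) ∧
    leftFunctional m t (ket c (w + 1) 1 1) = leftCoeff m t (c + 1) (w + 1) / 2 ∧
    leftFunctional m t (ket c (w + 1) 2 1) = leftCoeff m t (c + 1) (w + 1) / 2 := by
  induction m generalizing c w with
  | zero => simp [leftFunctional_zero, leftCoeff, ket]
  | succ m ih =>
    have i0 : ∀ c w, leftFunctional m t (ket c (w + 1) 0 1) = leftCoeff m t c (w + 1) :=
      fun c w => (ih c w).1
    have i1 : ∀ c w, leftFunctional m t (ket c (w + 1) 1 1) = leftCoeff m t (c + 1) (w + 1) / 2 :=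
      fun c w => (ih c w).2.1
    have i2 : ∀ c w, leftFunctional m t (ket c (w + 1) 2 1) = leftCoeff m t (c + 1) (w + 1) / 2 :=
      fun c w => (ih c w).2.2
    have f : ∀ (c w : ℕ), (if c + 1 = m ∧ w + 2 + m = t then (freeWeight m 1 : ℝ) else 0)
        = if c + 1 = m ∧ m + (w + 2) = t then (4 : ℝ) ^ c else 0 := by
      intro c w
      by_cases h : c + 1 = m ∧ w + 2 + m = t
      · rw [if_pos h, if_pos (by omega), ← h.1]; simp [freeWeight]
      · rw [if_neg h, if_neg (by omega)]
    have f2 : freeWeight m 2 = freeWeight m 1 := by cases m <;> simp [freeWeight]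
    have f0 : freeWeight m 0 + 2 * freeWeight m 1 = 4 ^ m := by
      cases m <;> simp [freeWeight]; ring
    have e0 : ∀ w, (w + 2 + m = t) = (m + 1 + (w + 1) = t) := fun w => propext (by omega)
    have key := leftCoeff_eq m t c (w + 2)
    have g : ∀ x : ℝ, ((if c + 1 = m ∧ m + 1 + (w + 1) = t then x * 4 ^ m else 0) : ℝ)
        = x * 4 * if c + 1 = m ∧ m + (w + 2) = t then (4 : ℝ) ^ c else 0 := by
      intro x
      by_cases h : c + 1 = m ∧ m + (w + 2) = t
      · rw [if_pos h, if_pos (by omega), ← h.1]; ring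
      · rw [if_neg h, if_neg (by omega)]; simp
    have g1 := g 1
    simp only [one_mul] at g1
    refine ⟨?_, ?_, ?_⟩
    · simp only [leftFunctional_succ, W_ket_zero_one, map_add, V_ket_one_zero, V_ket_zero_one,
        V_ket_one_one, V_ket_two_one, i0, i1, i2, leftFunctional_ket_zero, leftCoeff, f2, f]
      rw [key]
      have : ((if c = m ∧ m + 1 + (w + 1) = t then (4 : ℝ) ^ m else 0))
          = (if c = m ∧ w + 2 + m = t then freeWeight m 0 else 0)
            + 2 * if c = m ∧ w + 2 + m = t then freeWeight m 1 else 0 := by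
        by_cases h : c = m ∧ w + 2 + m = t
        · rw [if_pos h, if_pos h, if_pos (by omega), f0]
        · rw [if_neg h, if_neg h, if_neg (by omega)]; simp
      rw [this]
      ring
    · simp only [leftFunctional_succ, W_ket_one_one, map_add, V_ket_zero_one, i0, i1, i2,
        leftFunctional_ket_zero, leftCoeff, f, g1]
      rw [key]
      ring
    · simp only [leftFunctional_succ, W_ket_two_one, map_add, V_ket_one_one, V_ket_two_one,
        i0, i1, i2, leftFunctional_ket_zero, leftCoeff, f2, f, g1]
      ring

theorem leftCoeff_shift (m t c w : ℕ) : leftCoeff m (t + 1) c (w + 1) = leftCoeff m t c w := by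
  induction m generalizing c w with
  | zero => rfl
  | succ m ih =>
    have h : (c = m ∧ m + 1 + (w + 1) = t + 1) ↔ (c = m ∧ m + 1 + w = t) := by omega
    simp only [leftCoeff, h]
    rw [ih, show w + 1 + 2 = w + 2 + 1 by ring, ih]

theorem leftCoeff_scale (m t c w : ℕ) :
    leftCoeff (m + 1) (t + 1) (c + 1) w = 4 * leftCoeff m t c w := by
  induction m generalizing c w with
  | zero => simp [leftCoeff]
  | succ m ih =>
    have h : (c + 1 = m + 1 ∧ m + 1 + 1 + w = t + 1) ↔ (c = m ∧ m + 1 + w = t) := by omega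
    rw [leftCoeff, ih, ih, leftCoeff]
    simp only [h]
    split_ifs <;> ring

theorem leftCoeff_eq_zero {m t c w : ℕ} (h : t < m + w) : leftCoeff m t c w = 0 := by
  induction m generalizing c w with
  | zero => rfl
  | succ m ih => rw [leftCoeff, ih (by omega), ih (by omega), if_neg (by omega)]; simp

/-- The defining recursion changes `w` and `c`. Translation in `(t, w)` (`leftCoeff_shift`) and the
factor `4` for a common step of `m`, `t`, `c` (`leftCoeff_scale`) bring both back to their original
values. -/
theorem leftCoeff_rec (m k c w : ℕ) :
    leftCoeff (m + 2) (m + 2 + (k + 1)) c w = 2 * leftCoeff (m + 1) (m + 1 + (k + 1)) c w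
      + 8 * leftCoeff m (m + k) c w + if c = m + 1 ∧ k + 1 = w then 4 ^ (m + 1) else 0 := by
  have h : (c = m + 1 ∧ m + 1 + 1 + w = m + k + 1 + 1 + 1) ↔ (c = m + 1 ∧ k + 1 = w) := by omega
  rw [leftCoeff, show m + 2 + (k + 1) = m + 1 + (k + 1) + 1 by ring, leftCoeff_shift,
    show m + 1 + (k + 1) + 1 = m + k + 1 + 1 + 1 by ring, show w + 2 = w + 1 + 1 by ring,
    leftCoeff_shift, leftCoeff_shift, leftCoeff_scale]
  simp only [h]
  ring_nf

theorem leftCoeff_rec_zero (m c : ℕ) :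
    leftCoeff (m + 2) (m + 2) c 0
      = 2 * leftCoeff (m + 1) (m + 1) c 0 + if c = m + 1 then 4 ^ (m + 1) else 0 := by
  rw [leftCoeff, leftCoeff_shift, leftCoeff_eq_zero (c := c + 1) (by omega)]
  simp

/-! ### The diagonal recursion for the left movers -/

/-- The recursion obeyed by the numbers of configurations. -/
def DiagonalRec (f : ℕ → ℕ → ℝ) : Prop :=
  ∀ m k, f (m + 2) (k + 1) = 2 * f (m + 1) (k + 1) + 8 * f m k

theorem DiagonalRec.add {f g : ℕ → ℕ → ℝ} (hf : DiagonalRec f) (hg : DiagonalRec g) :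
    DiagonalRec fun m k => f m k + g m k := fun m k => by
  simp only [hf m k, hg m k]; ring

theorem DiagonalRec.unique {f g : ℕ → ℕ → ℝ} (hf : DiagonalRec f) (hg : DiagonalRec g)
    (h₀ : ∀ k, f 0 k = g 0 k) (h₁ : ∀ k, f 1 k = g 1 k) (h : ∀ m, f m 0 = g m 0) (m k : ℕ) :
    f m k = g m k := by
  induction m using Nat.strong_induction_on generalizing k with
  | _ m ih =>
    match m, k with
    | 0, k => exact h₀ k
    | 1, k => exact h₁ k
    | m + 2, 0 => exact h _
    | m + 2, k + 1 => rw [hf, hg, ih (m + 1) (by omega), ih m (by omega)]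

/-- The vectors created from `|r⟩` by the empty half of the chain. -/
def leftSource : ℕ → Aux
  | 0 => rVec + ket 1 0 1 0 + ket 1 1 1 1
  | j + 1 => ket 1 (j + 1) 1 0 + ket 0 (j + 1) 0 1 + ket 1 (j + 2) 1 1 + ket 0 (j + 1) 2 1

theorem empty_leftSource_zero : V0 (W0 (leftSource 0)) = leftSource 0 + leftSource 1 := by
  simp [leftSource, rVec, V0, W0, e_ket, E_ket, cUp_ket, wUp_ket, wDown_ket_succ, wDown_ket_zero,
    pow_two]
  abel

theorem empty_leftSource_succ (j : ℕ) : V0 (W0 (leftSource (j + 1))) = leftSource (j + 2) := by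
  simp [leftSource, V0, W0, e_ket, E_ket, cUp_ket, wUp_ket, wDown_ket_succ, pow_two]

/-- `V0 * W0` reproduces `leftSource 0` while emitting `leftSource 1`, and moves every later source
on by one. So each further empty period adds exactly one source. -/
theorem empty_rVec (k : ℕ) :
    (V0 * (W0 * V0) ^ k : Op) rVec = ∑ j ∈ Finset.range (k + 1), leftSource j := by
  induction k with
  | zero =>
    simp [leftSource, rVec, V0, e_ket, E_ket, cUp_ket, wUp_ket, wDown_ket_zero]
    abel
  | succ k ih =>
    have h : (V0 * (W0 * V0) ^ (k + 1) : Op) = V0 * W0 * (V0 * (W0 * V0) ^ k) := by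
      rw [pow_succ']; simp only [mul_assoc]
    rw [h, Module.End.mul_apply, ih, Module.End.mul_apply, map_sum, map_sum,
      Finset.sum_range_succ', empty_leftSource_zero]
    simp only [empty_leftSource_succ]
    rw [Finset.sum_range_succ' (n := k + 1), Finset.sum_range_succ' (n := k)]
    abel

theorem L_eq_sum (m k : ℕ) :
    L m (m + k) = ∑ j ∈ Finset.range (k + 1), leftFunctional m (m + k) (leftSource j) := by
  rw [L, Nat.add_sub_cancel_left, lVec, bracket_ket, mul_assoc, Module.End.mul_apply, empty_rVec,
    ← map_sum]
  rfl

/-- The vectors that leave the sector of `|r⟩` in one period. -/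
def leftEmission : Aux :=
  (2 : ℝ) • (ket 1 0 1 0 + ket 1 1 1 1 + ket 0 0 1 0 + ket 0 0 2 0 + ket 0 1 1 1 + ket 0 1 2 1)
  + (ket 0 1 0 0
    + (2 : ℝ) • (ket 1 1 1 0 + ket 0 1 0 1 + ket 1 2 1 1 + ket 0 1 2 1)
    + ket 1 2 0 1 + (ket 0 1 1 0 + ket 0 1 2 0 + ket 0 2 1 1 + ket 0 2 2 1)
    + (2 : ℝ) • ket 1 1 0 1 + (ket 1 1 1 0 + ket 1 1 2 0 + ket 1 2 1 1 + ket 1 2 2 1))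

/-- `|r⟩` is an eigenvector up to emission. All emitted vectors have `a = 0` or `w ≥ 1`, where the
left functional is already known. -/
theorem period_rVec : (V0 + V1) ((W0 + W1) rVec) = (4 : ℝ) • rVec + leftEmission := by
  have hW : (W0 + W1) rVec = (2 : ℝ) • rVec + (ket 0 1 1 0 + (2 : ℝ) • ket 0 1 0 1 + ket 1 2 1 1
      + ket 0 1 2 1 + (2 : ℝ) • ket 1 1 1 1 + ket 1 1 2 1) := by
    simp [rVec, W0, W1, e_ket, E_ket, cUp_ket, wUp_ket, pow_two]
    module
  have hV : (V0 + V1) rVec = (2 : ℝ) • rVec + (ket 1 0 1 0 + ket 1 1 1 1 + ket 0 0 1 0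
      + ket 0 0 2 0 + ket 0 1 1 1 + ket 0 1 2 1) := by
    simp [rVec, V0, V1, e_ket, E_ket, cUp_ket, wUp_ket, wDown_ket_zero]
    module
  rw [hW, map_add, map_smul, hV]
  simp only [map_add, map_smul]
  have h1 := V_ket_zero_one 0 0
  have h2 := V_ket_one_one 1 1
  have h3 := V_ket_two_one 0 0
  have h4 := V_ket_one_one 1 0
  have h5 := V_ket_two_one 1 0
  simp only [zero_add, one_add_one_eq_two] at h1 h2 h3 h4 h5
  rw [V_ket_one_zero, h1, h2, h3, h4, h5, leftEmission]
  module

/-- The contribution of the vectors that leave the sector of `|r⟩`. -/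
def leftEmissionCount (m k : ℕ) : ℝ :=
  leftCoeff m (m + k) 2 1 + 5 * leftCoeff m (m + k) 1 1 + 2 * leftCoeff m (m + k) 0 1
  + 2 * leftCoeff m (m + k) 2 2 + 2 * leftCoeff m (m + k) 1 2
  + (if m = 1 ∧ k = 0 then 2 else 0) + (if m = 0 ∧ k = 1 then 1 else 0)
  + if m = 1 ∧ k = 1 then 4 else 0

theorem leftFunctional_leftEmission (m k : ℕ) :
    leftFunctional m (m + k) leftEmission = leftEmissionCount m k := by
  have i0 : ∀ c w, leftFunctional m (m + k) (ket c (w + 1) 0 1) = leftCoeff m (m + k) c (w + 1) :=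
    fun c w => (leftFunctional_ket_one m _ c w).1
  have i1 : ∀ c w, leftFunctional m (m + k) (ket c (w + 1) 1 1)
      = leftCoeff m (m + k) (c + 1) (w + 1) / 2 := fun c w => (leftFunctional_ket_one m _ c w).2.1
  have i2 : ∀ c w, leftFunctional m (m + k) (ket c (w + 1) 2 1)
      = leftCoeff m (m + k) (c + 1) (w + 1) / 2 := fun c w => (leftFunctional_ket_one m _ c w).2.2
  have a01 := i0 0 0
  have a02 := i0 1 1
  have a03 := i0 1 0
  have b1 := i1 1 0
  have b2 := i1 0 0
  have b3 := i1 1 1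
  have b4 := i1 0 1
  have c1 := i2 0 0
  have c2 := i2 0 1
  have c3 := i2 1 1
  simp only [zero_add, one_add_one_eq_two] at a01 a02 a03 b1 b2 b3 b4 c1 c2 c3
  simp only [leftEmission, map_add, map_smul, a01, a02, a03, b1, b2, b3, b4, c1, c2, c3,
    leftFunctional_ket_zero, leftEmissionCount, smul_eq_mul]
  rcases m with _ | _ | m
  · rcases k with _ | _ | k <;> simp [freeWeight] <;> ring
  · rcases k with _ | _ | k
    · simp [freeWeight]; ring
    · simp [freeWeight]; ring
    · have h : ¬ 2 = 1 + (k + 1 + 1) := by omega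
      simp [h]; ring
  · simp; ring

theorem leftEmissionCount_rec (m k : ℕ) :
    leftEmissionCount (m + 2) (k + 2)
      = 2 * leftEmissionCount (m + 1) (k + 2) + 8 * leftEmissionCount m (k + 1) := by
  simp only [leftEmissionCount, show k + 2 = k + 1 + 1 by ring, leftCoeff_rec]
  rcases m with _ | _ | m <;> rcases k with _ | k <;> simp <;> ring

/-- The contribution of the sector of `|r⟩`. -/
def leftCount (m k : ℕ) : ℝ := leftFunctional m (m + k) rVec

theorem leftCount_zero (k : ℕ) : leftCount 0 k = 0 := by
  simp [leftCount, leftFunctional_zero, rVec, ket]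

theorem leftCount_succ (m k : ℕ) :
    leftCount (m + 1) k = 4 * leftCount m (k + 1) + leftEmissionCount m (k + 1) := by
  rw [leftCount, leftFunctional_succ, period_rVec, map_add, map_smul,
    show m + 1 + k = m + (k + 1) by ring, leftFunctional_leftEmission]
  rfl

theorem leftCount_one (k : ℕ) : leftCount 1 k = if k = 0 then 1 else 0 := by
  rw [leftCount_succ, leftCount_zero]
  simp [leftEmissionCount, leftCoeff]

/-- The relation `leftCount_succ` is linear with source `leftEmissionCount`. As the source obeys the
diagonal recursion (`leftEmissionCount_rec`), it passes to `leftCount` by induction on `m`. -/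
theorem diagonalRec_leftCount : DiagonalRec leftCount := by
  intro m
  induction m with
  | zero =>
    intro k
    have h : ¬ 2 = 1 + (k + 1 + 1) := by omega
    rw [leftCount_succ, leftCount_one, leftCount_one, leftCount_zero]
    simp [leftEmissionCount, leftCoeff, h]
  | succ m ih =>
    intro k
    have a : leftCount (m + 3) (k + 1) = _ := leftCount_succ (m + 2) (k + 1)
    have b : leftCount (m + 2) (k + 2) = _ := ih (k + 1)
    have c := leftEmissionCount_rec m k
    have d : leftCount (m + 2) (k + 1) = _ := leftCount_succ (m + 1) (k + 1)
    have e := leftCount_succ m k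
    change leftCount (m + 3) (k + 1) = 2 * leftCount (m + 2) (k + 1) + 8 * leftCount (m + 1) k
    simp only [show k + 1 + 1 = k + 2 by ring] at a b c d e
    linarith

theorem leftCoeff_diag (m : ℕ) : leftCoeff (m + 1) (m + 1) 0 0 = 2 ^ m := by
  induction m with
  | zero => simp [leftCoeff]
  | succ m ih => rw [leftCoeff_rec_zero, ih]; simp; ring

theorem leftCoeff_diag_one (m : ℕ) : leftCoeff (m + 2) (m + 2) 1 0 = 4 * 2 ^ m := by
  rw [leftCoeff_scale, leftCoeff_diag]

theorem leftCoeff_diag_two (m : ℕ) : leftCoeff (m + 3) (m + 3) 2 0 = 16 * 2 ^ m := by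
  rw [leftCoeff_scale, leftCoeff_diag_one]; ring

theorem leftEmissionCount_diag (m : ℕ) : leftEmissionCount (m + 3) 1 = 64 * 2 ^ m := by
  rw [leftEmissionCount, leftCoeff_shift, leftCoeff_shift, leftCoeff_shift, leftCoeff_diag_two,
    leftCoeff_diag_one, leftCoeff_diag, leftCoeff_eq_zero (by omega), leftCoeff_eq_zero (by omega)]
  simp; ring

/-- The diagonal recursion does not reach the column `k = 0`. It is obtained from `leftCount_succ`,
which needs the column `k = 1`, so both columns are computed in one induction. -/
theorem leftCount_diag (m : ℕ) : leftCount (m + 2) 0 = 6 * 4 ^ m ∧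
    leftCount (m + 3) 0 = 24 * 4 ^ m ∧ leftCount (m + 3) 1 = 24 * 4 ^ m - 16 * 2 ^ m := by
  have b₁ : leftCount 1 1 = 0 := by simp [leftCount_one]
  have b₂ : leftCount 2 1 = 0 := by
    rw [diagonalRec_leftCount 0 0, leftCount_zero, b₁]; norm_num
  induction m with
  | zero =>
    have h₁ : leftEmissionCount 1 1 = 6 := by
      norm_num [leftEmissionCount, leftCoeff]
    have h₂ : leftEmissionCount 2 1 = 24 := by
      norm_num [leftEmissionCount, leftCoeff]
    refine ⟨?_, ?_, ?_⟩
    · rw [leftCount_succ, b₁, h₁]; norm_num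
    · rw [leftCount_succ, b₂, h₂]; norm_num
    · rw [diagonalRec_leftCount 1 0, b₂, leftCount_one]; norm_num
  | succ m ih =>
    obtain ⟨i₁, i₂, i₃⟩ := ih
    refine ⟨?_, ?_, ?_⟩
    · rw [show m + 1 + 2 = m + 3 by ring, i₂]; ring
    · rw [leftCount_succ, show m + 1 + 2 = m + 3 by ring, leftEmissionCount_diag, i₃]; ring
    · rw [show m + 1 + 3 = m + 2 + 2 by ring, diagonalRec_leftCount, show m + 2 + 1 = m + 3 by ring,
        i₁, i₃]
      ring

/-- The contribution of the solitons that are selected in the empty half of the chain. -/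
def emptyCount (m k : ℕ) : ℝ :=
  ∑ j ∈ Finset.range k, leftFunctional m (m + k) (leftSource (j + 1))

/-- The last term of `emptyCount`. -/
def emptyTerm (m k : ℕ) : ℝ :=
  leftCoeff m (m + k) 0 0 + leftCoeff m (m + k) 2 1 / 2 + leftCoeff m (m + k) 1 0 / 2
    + if m = 1 ∧ k = 0 then 1 else 0

theorem leftFunctional_leftSource (m t j : ℕ) :
    leftFunctional m t (leftSource (j + 1)) = leftCoeff m t 0 (j + 1)
      + leftCoeff m t 2 (j + 2) / 2 + leftCoeff m t 1 (j + 1) / 2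
      + if m = 1 ∧ j + 2 = t then 1 else 0 := by
  rw [leftSource, map_add, map_add, map_add, leftFunctional_ket_zero,
    (leftFunctional_ket_one m t 0 j).1,
    show j + 2 = j + 1 + 1 by ring, (leftFunctional_ket_one m t 1 (j + 1)).2.1,
    (leftFunctional_ket_one m t 0 j).2.2]
  by_cases h : m = 1
  · subst h; simp [freeWeight]; ring
  · simp [h, Ne.symm h]

/-- By the translation symmetry of `leftCoeff`, source `j + 2` at time `t + 1` contributes as much
as source `j + 1` at time `t`. Only the first source is new. -/
theorem emptyCount_succ (m k : ℕ) : emptyCount m (k + 1) = emptyCount m k + emptyTerm m k := by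
  rw [emptyCount, Finset.sum_range_succ', emptyCount]
  congr 1
  · refine Finset.sum_congr rfl fun j _ => ?_
    rw [leftFunctional_leftSource, leftFunctional_leftSource, ← Nat.add_assoc, leftCoeff_shift,
      show j + 1 + 2 = j + 2 + 1 by ring, leftCoeff_shift, leftCoeff_shift]
    simp
  · have h : (m = 1 ∧ 0 + 2 = m + (k + 1)) ↔ (m = 1 ∧ k = 0) := by omega
    rw [leftFunctional_leftSource, emptyTerm]
    simp only [h]
    rw [← Nat.add_assoc, leftCoeff_shift, show 0 + 2 = 1 + 1 by rfl, leftCoeff_shift,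
      leftCoeff_shift]

theorem emptyTerm_rec : DiagonalRec emptyTerm := by
  intro m k
  simp only [emptyTerm, leftCoeff_rec]
  rcases m with _ | _ | m <;> rcases k with _ | k <;> simp <;> ring

theorem emptyTerm_rec_zero (m : ℕ) : emptyTerm (m + 2) 0 = 2 * emptyTerm (m + 1) 0 := by
  simp only [emptyTerm, add_zero, leftCoeff_rec_zero]
  rw [leftCoeff_eq_zero (show m + 2 < m + 2 + 1 by omega),
    leftCoeff_eq_zero (show m + 1 < m + 1 + 1 by omega)]
  rcases m with _ | m <;> simp <;> ring

theorem diagonalRec_emptyCount : DiagonalRec emptyCount := by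
  intro m k
  induction k with
  | zero =>
    rw [emptyCount_succ, emptyCount_succ, emptyTerm_rec_zero]
    simp [emptyCount]
  | succ k ih =>
    rw [emptyCount_succ, ih, emptyTerm_rec, emptyCount_succ (m + 1) (k + 1), emptyCount_succ m]
    ring

theorem emptyCount_zero (k : ℕ) : emptyCount 0 k = 0 := by
  induction k with
  | zero => rfl
  | succ k ih => rw [emptyCount_succ, ih]; simp [emptyTerm, leftCoeff]

theorem emptyCount_one (k : ℕ) : emptyCount 1 (k + 1) = 2 := by
  induction k with
  | zero => norm_num [emptyCount_succ, emptyTerm, leftCoeff]; norm_num [emptyCount]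
  | succ k ih => rw [emptyCount_succ, ih]; simp [emptyTerm, leftCoeff]

/-- The contribution of the soliton that is selected at the end of the empty half. -/
def lastCount (m k : ℕ) : ℝ :=
  leftCoeff m (m + k) 2 1 / 2 + if m = 1 ∧ k = 0 then 1 else 0

theorem diagonalRec_lastCount : DiagonalRec lastCount := by
  intro m k
  simp only [lastCount, leftCoeff_rec]
  rcases m with _ | _ | m <;> rcases k with _ | k <;> simp <;> ring

theorem L_eq (m k : ℕ) : L m (m + k) = leftCount m k + lastCount m k + emptyCount m k := by
  have h := (leftFunctional_ket_one m (m + k) 1 0).2.1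
  rw [zero_add] at h
  rw [L_eq_sum, Finset.sum_range_succ', ← emptyCount, leftSource, map_add, map_add, ← leftCount,
    leftFunctional_ket_zero, h, lastCount]
  by_cases hm : m = 1
  · subst hm; by_cases hk : k = 0
    · subst hk; simp [freeWeight]; ring
    · simp [hk]; ring
  · simp [hm, Ne.symm hm]; ring

theorem diagonalRec_L : DiagonalRec fun m k => L m (m + k) := by
  have := (diagonalRec_leftCount.add diagonalRec_lastCount).add diagonalRec_emptyCount
  simpa only [← L_eq] using this

theorem L_zero (k : ℕ) : L 0 (0 + k) = 0 := by
  rw [L_eq, leftCount_zero, emptyCount_zero]; simp [lastCount, leftCoeff]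

theorem L_one (k : ℕ) : L 1 (1 + k) = 2 := by
  rw [L_eq, leftCount_one]
  cases k with
  | zero => norm_num [lastCount, leftCoeff, emptyCount]
  | succ k => rw [emptyCount_one]; simp [lastCount, leftCoeff]

theorem L_diag (m : ℕ) : L (m + 2) (m + 2 + 0) = 6 * 4 ^ m := by
  rw [L_eq, (leftCount_diag m).1, lastCount, leftCoeff_eq_zero (by omega)]
  simp [emptyCount]

/-! ### Pascal triangles with integer entries -/

/-- The Pascal triangle with a given row `0`. -/
def pascalNat (f : ℤ → ℝ) : ℕ → ℤ → ℝ
  | 0, k => f k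
  | n + 1, k => pascalNat f n k + pascalNat f n (k - 1)

/-- The Pascal triangle with a given row `0`, extended by zero to negative rows. -/
def pascal (f : ℤ → ℝ) (n k : ℤ) : ℝ := if 0 ≤ n then pascalNat f n.toNat k else 0

theorem pascal_natCast (f : ℤ → ℝ) (n : ℕ) (k : ℤ) : pascal f n k = pascalNat f n k := by
  simp [pascal]

theorem pascal_of_neg (f : ℤ → ℝ) {n : ℤ} (hn : n < 0) (k : ℤ) : pascal f n k = 0 := by
  rw [pascal, if_neg (by omega)]

/-- Rows of negative index are zero, so Pascal's rule holds for all integers up to a correction that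
creates row `0` from row `-1`. These corrections account for the Kronecker terms met below. -/
theorem pascal_succ (f : ℤ → ℝ) (n k : ℤ) :
    pascal f (n + 1) k = pascal f n k + pascal f n (k - 1) + if n = -1 then f k else 0 := by
  rcases lt_trichotomy n (-1) with h | h | h
  · rw [pascal_of_neg f (by omega), pascal_of_neg f (by omega), pascal_of_neg f (by omega),
      if_neg (by omega)]
    simp
  · subst h
    simp [pascal, pascalNat]
  · obtain ⟨n, rfl⟩ := Int.eq_ofNat_of_zero_le (show 0 ≤ n by omega)
    rw [if_neg (by omega), pascal_natCast, pascal_natCast, ← Nat.cast_succ, pascal_natCast,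
      pascalNat, add_zero]

/-- Binomial coefficients. -/
def choosePascal : ℤ → ℤ → ℝ := pascal fun k => if k = 0 then 1 else 0

/-- The sums of the binomial coefficients `n.choose y` over `y ≥ k`. -/
def tailPascal : ℤ → ℤ → ℝ := pascal fun k => if k ≤ 0 then 1 else 0

theorem choosePascal_succ (n k : ℤ) : choosePascal (n + 1) k
    = choosePascal n k + choosePascal n (k - 1) + if n = -1 ∧ k = 0 then 1 else 0 := by
  rw [choosePascal, pascal_succ]; simp only [ite_and]

theorem tailPascal_succ (n k : ℤ) : tailPascal (n + 1) k
    = tailPascal n k + tailPascal n (k - 1) + if n = -1 ∧ k ≤ 0 then 1 else 0 := by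
  rw [tailPascal, pascal_succ]; simp only [ite_and]

theorem choosePascal_of_neg {n : ℤ} (hn : n < 0) (k : ℤ) : choosePascal n k = 0 :=
  pascal_of_neg _ hn k

theorem tailPascal_of_neg {n : ℤ} (hn : n < 0) (k : ℤ) : tailPascal n k = 0 :=
  pascal_of_neg _ hn k

theorem choosePascal_of_right_neg (n : ℤ) {k : ℤ} (hk : k < 0) : choosePascal n k = 0 := by
  by_cases hn : n < 0
  · exact choosePascal_of_neg hn k
  obtain ⟨n, rfl⟩ := Int.eq_ofNat_of_zero_le (not_lt.1 hn)
  induction n generalizing k with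
  | zero => simp [choosePascal, pascal, pascalNat]; omega
  | succ n ih =>
    rw [Nat.cast_succ, choosePascal_succ, ih hk (by omega), ih (by omega) (by omega),
      if_neg (by omega)]
    simp

theorem tailPascal_of_nonpos (n : ℕ) {k : ℤ} (hk : k ≤ 0) : tailPascal n k = 2 ^ n := by
  induction n generalizing k with
  | zero => simp [tailPascal, pascal, pascalNat, hk]
  | succ n ih =>
    rw [Nat.cast_succ, tailPascal_succ, ih hk, ih (by omega), if_neg (by omega)]
    ring

theorem tailPascal_sub_one (n k : ℤ) :
    tailPascal n (k - 1) = tailPascal n k + choosePascal n (k - 1) := by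
  by_cases hn : n < 0
  · simp [tailPascal_of_neg hn, choosePascal_of_neg hn]
  obtain ⟨n, rfl⟩ := Int.eq_ofNat_of_zero_le (not_lt.1 hn)
  induction n generalizing k with
  | zero =>
    rcases lt_trichotomy k 1 with h | h | h
    · simp [tailPascal, choosePascal, pascal, pascalNat, show k ≤ 1 by omega, show k ≤ 0 by omega,
        show ¬ k - 1 = 0 by omega]
    · subst h; simp [tailPascal, choosePascal, pascal, pascalNat]
    · simp [tailPascal, choosePascal, pascal, pascalNat, show ¬ k ≤ 1 by omega,
        show ¬ k ≤ 0 by omega, show ¬ k - 1 = 0 by omega]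
  | succ n ih =>
    rw [Nat.cast_succ, tailPascal_succ, tailPascal_succ, choosePascal_succ,
      if_neg (by omega), if_neg (by omega), if_neg (by omega)]
    linarith [ih k (by omega), ih (k - 1) (by omega)]

/-! ### The right movers -/

theorem bracket_comm (u v : Aux) : bracket u v = bracket v u := by
  induction v using Finsupp.induction_linear with
  | zero => simp [bracket]
  | add f g hf hg => rw [bracket_add, hf, hg, bracket_eq, bracket_eq, bracket_eq, map_add]
  | single i r =>
    induction u using Finsupp.induction_linear with
    | zero => simp [bracket]
    | add f g hf hg =>
      rw [bracket_add, ← hf, ← hg, bracket_eq, bracket_eq, bracket_eq, map_add]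
    | single j q =>
      simp only [bracket, zero_mul, Finsupp.sum_single_index, Finsupp.single_apply,
        eq_comm (a := i)]
      split_ifs <;> ring

theorem IsTranspose.symm {A B : Op} (h : IsTranspose A B) : IsTranspose B A := fun u v => by
  rw [bracket_comm, ← h, bracket_comm]

theorem IsTranspose.sub {A B A' B' : Op} (h : IsTranspose A B) (h' : IsTranspose A' B') :
    IsTranspose (A - A') (B - B') := by
  intro u v
  have hs : ∀ w a b : Aux, bracket w (a - b) = bracket w a - bracket w b := fun w a b => by
    rw [bracket_comm, bracket_comm w a, bracket_comm w b]
    simp [bracket_eq]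
  rw [LinearMap.sub_apply, LinearMap.sub_apply, hs, h u v, h' u v, bracket_comm _ v,
    bracket_comm _ v, ← hs, bracket_comm]

theorem IsTranspose.pow {A B : Op} (h : IsTranspose A B) (n : ℕ) :
    IsTranspose (A ^ n) (B ^ n) := by
  induction n with
  | zero => intro u v; simp
  | succ n ih => rw [pow_succ, pow_succ']; exact ih.mul h

/-- The transpose of `V0'`. -/
def V0R : Op :=
  V0 - (E (1, 1, 1, 1) (0, 0, 0, 1) + E (1, 2, 1, 1) (0, 1, 0, 1) + E (1, 1, 1, 0) (0, 1, 0, 1))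

/-- The transpose of `W0'`. -/
def W0R : Op := W0 - (E (1, 1, 1, 1) (0, 0, 0, 1) + E (1, 2, 1, 1) (0, 0, 0, 1))

/-- The transpose of `W1'`. -/
def W1R : Op :=
  W1 - (E (1, 1, 1, 1) (0, 0, 2, 1) + E (1, 1, 2, 1) (0, 0, 2, 1)
    + E (1, 2, 1, 1) (0, 1, 2, 1) + E (1, 2, 2, 1) (0, 1, 2, 1))

theorem isTranspose_V0' : IsTranspose V0' V0R :=
  isTranspose_V0.symm.sub (((isTranspose_E _ _).add (isTranspose_E _ _)).add (isTranspose_E _ _))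

theorem isTranspose_V1' : IsTranspose V1' V1 := isTranspose_V1.symm

theorem isTranspose_W0' : IsTranspose W0' W0R :=
  isTranspose_W0.symm.sub ((isTranspose_E _ _).add (isTranspose_E _ _))

theorem isTranspose_W1' : IsTranspose W1' W1R :=
  isTranspose_W1.symm.sub ((((isTranspose_E _ _).add (isTranspose_E _ _)).add
    (isTranspose_E _ _)).add (isTranspose_E _ _))

/-- The functional `⟨k, w, 0, 0|((W₀' + W₁')(V₀' + V₁'))^m` with transposed matrices. -/
def rightFunctional (k w m : ℕ) : Aux →ₗ[ℝ] ℝ :=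
  Finsupp.lapply (k, w, 0, 0) ∘ₗ (((W0R + W1R) * (V0R + V1)) ^ m : Op)

theorem rightFunctional_zero (k w : ℕ) (v : Aux) : rightFunctional k w 0 v = v (k, w, 0, 0) := by
  simp [rightFunctional]

theorem rightFunctional_succ (k w m : ℕ) (v : Aux) :
    rightFunctional k w (m + 1) v = rightFunctional k w m ((W0R + W1R) ((V0R + V1) v)) := by
  simp [rightFunctional, pow_succ]

theorem Aux.linearMap_ext {f g : Aux →ₗ[ℝ] ℝ} (h : ∀ c w n a, f (ket c w n a) = g (ket c w n a)) :
    f = g :=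
  Finsupp.lhom_ext' fun ⟨c, w, n, a⟩ => LinearMap.ext_ring (h c w n a)

theorem V0R_apply (v : Aux) (c w : ℕ) : V0R v (c, w, 0, 0) = v (c, w, 0, 0) := by
  have : Finsupp.lapply (c, w, 0, 0) ∘ₗ V0R = (Finsupp.lapply (c, w, 0, 0) : Aux →ₗ[ℝ] ℝ) := by
    refine Aux.linearMap_ext fun c' w' n a => ?_
    fin_cases n <;> fin_cases a <;> rcases w' with _ | w' <;>
      simp [V0R, V0, e_ket, E_ket, cUp_ket, wUp_ket, wDown_ket_succ, wDown_ket_zero] <;>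
      simp [ket] <;> split_ifs <;> simp
  exact LinearMap.congr_fun this v

theorem W0R_apply (v : Aux) (c w : ℕ) : W0R v (c, w + 1, 0, 0) = v (c + 1, w, 0, 0) := by
  have : Finsupp.lapply (c, w + 1, 0, 0) ∘ₗ W0R
      = (Finsupp.lapply (c + 1, w, 0, 0) : Aux →ₗ[ℝ] ℝ) := by
    refine Aux.linearMap_ext fun c' w' n a => ?_
    fin_cases n <;> fin_cases a <;> rcases c' with _ | c' <;>
      simp [W0R, W0, e_ket, E_ket, cUp_ket, wUp_ket, cDown_ket_succ, cDown_ket_zero, pow_two] <;>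
      simp [ket, Finsupp.single_apply] <;> split_ifs <;> simp
  exact LinearMap.congr_fun this v

theorem empty_apply (k c w : ℕ) (v : Aux) :
    ((V0R * W0R) ^ k : Op) v (c, w + k, 0, 0) = v (c + k, w, 0, 0) := by
  induction k generalizing c with
  | zero => simp
  | succ k ih =>
    rw [pow_succ', Module.End.mul_apply, Module.End.mul_apply, V0R_apply,
      ← Nat.add_assoc, W0R_apply, ih, show c + 1 + k = c + (k + 1) by ring]

/-- After transposition the empty half acts on a row vector `⟨c, w, 0, 0|`, where `V0R` acts
trivially and `W0R` trades one unit of `w` for one of `c`. Its `k` periods turn `⟨0, t + 1, 0, 0|`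
into `⟨k, m + 1, 0, 0|`. -/
theorem R_eq (m k : ℕ) : R m (m + k) = rightFunctional k (m + 1) m lVec' := by
  have h : IsTranspose (((V0' + V1') * (W0' + W1')) ^ m * V0' * (W0' * V0') ^ k)
      ((V0R * W0R) ^ k * (V0R * ((W0R + W1R) * (V0R + V1)) ^ m)) :=
    ((((isTranspose_V0'.add isTranspose_V1').mul (isTranspose_W0'.add isTranspose_W1')).pow m).mul
      isTranspose_V0').mul ((isTranspose_W0'.mul isTranspose_V0').pow k)
  rw [R, Nat.add_sub_cancel_left, h, bracket_comm, rVec', bracket_ket, Module.End.mul_apply,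
    show m + k + 1 = m + 1 + k by ring, empty_apply, Module.End.mul_apply, V0R_apply, zero_add]
  rfl

theorem VR_ket {c w : ℕ} {n : Fin 3} {a : Fin 2}
    (h : ¬ (c = 0 ∧ w = 0 ∧ n = 0 ∧ a = 1)) (h' : ¬ (c = 0 ∧ w = 1 ∧ n = 0 ∧ a = 1)) :
    (V0R + V1) (ket c w n a) = (V0 + V1) (ket c w n a) := by
  simp only [V0R, LinearMap.add_apply, LinearMap.sub_apply, E_ket, if_neg h, if_neg h']
  simp

theorem WR_ket {c w : ℕ} {n : Fin 3} {a : Fin 2} (h₀ : ¬ (c = 0 ∧ w = 0 ∧ n = 0 ∧ a = 1))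
    (h : ¬ (c = 0 ∧ w = 0 ∧ n = 2 ∧ a = 1)) (h' : ¬ (c = 0 ∧ w = 1 ∧ n = 2 ∧ a = 1)) :
    (W0R + W1R) (ket c w n a) = (W0 + W1) (ket c w n a) := by
  simp only [W0R, W1R, LinearMap.add_apply, LinearMap.sub_apply, E_ket, if_neg h, if_neg h',
    if_neg h₀]
  simp

theorem rightFunctional_ket_zero (k W m c w : ℕ) (n : Fin 3) :
    rightFunctional k W m (ket c w n 0)
      = if c = k + m ∧ w + m = W then freeWeight m n else 0 := by
  have hV : ∀ c w n, (V0R + V1) (ket c w n 0) = (V0 + V1) (ket c w n 0) := fun c w n =>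
    VR_ket (by simp) (by simp)
  have hW : ∀ c w n, (W0R + W1R) (ket c w n 0) = (W0 + W1) (ket c w n 0) := fun c w n =>
    WR_ket (by simp) (by simp) (by simp)
  induction m generalizing c w n with
  | zero =>
    rw [rightFunctional_zero]
    simp only [ket, Finsupp.single_apply, freeWeight, Prod.mk.injEq]
    split_ifs <;> simp_all
  | succ m ih =>
    rw [rightFunctional_succ]
    rcases c with _ | c
    · fin_cases n <;> simp [hV, V_ket_zero_zero, V_ket_one_zero, V_ket_two_zero, hW, W_ket_zero,
        -LinearMap.add_apply]
    · have h : (c + 1 = k + (m + 1) ∧ w + (m + 1) = W) ↔ (c = k + m ∧ w + 1 + m = W) := by omega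
      simp only [h]
      fin_cases n
      · simp only [Fin.zero_eta, hV, V_ket_zero_zero, map_add, hW, W_ket_zero_zero, W_ket_one_zero,
          W_ket_two_zero, ih]
        split_ifs
        · cases m <;> simp [freeWeight] <;> ring
        · simp
      · simp only [Fin.mk_one, hV, V_ket_one_zero, hW, W_ket_zero_zero, map_add, ih]
        split_ifs
        · cases m <;> simp [freeWeight]; ring
        · simp
      · simp only [Fin.reduceFinMk, hV, V_ket_two_zero, map_add, hW, W_ket_one_zero,
          W_ket_two_zero, ih]
        split_ifs
        · cases m <;> simp [freeWeight]; ring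
        · simp

/-! ### The right functional as a product of two Pascal triangles -/

/-- The closed form of the right functional on the sector before the selection of a soliton. -/
def rightCoeff (m : ℕ) (κ d : ℤ) (n : Fin 3) : ℝ :=
  if n = 0 then tailPascal (m - κ + d - 1) κ * choosePascal (m + κ - d - 1) d
  else if n = 1 then tailPascal (m - κ + d - 2) κ * choosePascal (m + κ - d - 1) d
  else tailPascal (m - κ + d - 2) κ * choosePascal (m + κ - d - 1) (d - 1)
      + if κ = -m ∧ d = 0 then freeWeight m 1 else 0

theorem rightCoeff_of_zero {m : ℕ} {κ d x y : ℤ} (hx : x = m - κ + d) (hy : y = m + κ - d) :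
    rightCoeff m κ d 0 = tailPascal (x - 1) κ * choosePascal (y - 1) d := by
  subst hx hy; rfl

theorem rightCoeff_of_one {m : ℕ} {κ d x y : ℤ} (hx : x = m - κ + d) (hy : y = m + κ - d) :
    rightCoeff m κ d 1 = tailPascal (x - 2) κ * choosePascal (y - 1) d := by
  subst hx hy; rfl

theorem rightCoeff_of_two {m : ℕ} {κ d x y : ℤ} (hx : x = m - κ + d) (hy : y = m + κ - d) :
    rightCoeff m κ d 2 = tailPascal (x - 2) κ * choosePascal (y - 1) (d - 1)
      + if κ = -m ∧ d = 0 then freeWeight m 1 else 0 := by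
  subst hx hy; rfl

theorem tailPascal_mul_choosePascal {a b : ℤ} (h : a + b < -1) (k l : ℤ) :
    tailPascal a k * choosePascal b l = 0 := by
  rcases lt_or_ge a 0 with ha | ha
  · rw [tailPascal_of_neg ha, zero_mul]
  · rw [choosePascal_of_neg (by omega), mul_zero]

theorem rightCoeff_zero (κ d : ℤ) (n : Fin 3) : rightCoeff 0 κ d n = 0 := by
  fin_cases n
  · exact (rightCoeff_of_zero rfl rfl).trans (tailPascal_mul_choosePascal (by omega) _ _)
  · exact (rightCoeff_of_one rfl rfl).trans (tailPascal_mul_choosePascal (by omega) _ _)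
  · refine (rightCoeff_of_two rfl rfl).trans ?_
    rw [tailPascal_mul_choosePascal (by omega)]
    simp [freeWeight]

theorem tailPascal_eq_add (n k : ℤ) : tailPascal n k
    = tailPascal (n - 1) k + tailPascal (n - 1) (k - 1) + if n = 0 ∧ k ≤ 0 then 1 else 0 := by
  have h : (n = 0 ∧ k ≤ 0) ↔ (n - 1 = -1 ∧ k ≤ 0) := by omega
  simp only [h]
  rw [← tailPascal_succ, sub_add_cancel]

theorem choosePascal_eq_add (n k : ℤ) : choosePascal n k
    = choosePascal (n - 1) k + choosePascal (n - 1) (k - 1) + if n = 0 ∧ k = 0 then 1 else 0 := by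
  have h : (n = 0 ∧ k = 0) ↔ (n - 1 = -1 ∧ k = 0) := by omega
  simp only [h]
  rw [← choosePascal_succ, sub_add_cancel]

theorem freeWeight_one (m : ℕ) : tailPascal (2 * m - 2) (-m) = freeWeight m 1 := by
  cases m with
  | zero => rw [tailPascal_of_neg (by norm_num)]; simp [freeWeight]
  | succ m =>
    have h : 2 * ((m + 1 : ℕ) : ℤ) - 2 = ((2 * m : ℕ) : ℤ) := by push_cast; ring
    rw [h, tailPascal_of_nonpos _ (by omega), pow_mul]
    norm_num [freeWeight]

theorem two_mul_freeWeight_one (m : ℕ) {k : ℤ} (hk : k ≤ 0) :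
    tailPascal (2 * m - 1) k = 2 * freeWeight m 1 := by
  cases m with
  | zero => rw [tailPascal_of_neg (by norm_num)]; simp [freeWeight]
  | succ m =>
    have h : 2 * ((m + 1 : ℕ) : ℤ) - 1 = ((2 * m + 1 : ℕ) : ℤ) := by push_cast; ring
    rw [h, tailPascal_of_nonpos _ hk, pow_succ, pow_mul]
    norm_num [freeWeight]; ring

/-- This relation and the two that follow express the action of one period. In the variables `x = m
- κ + d` and `y = m + κ - d` each is Pascal's rule for the one factor combined with Pascal's rule
for the other; the corrections at row `-1` supply the vectors that pass to `a = 0`. -/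
theorem rightCoeff_succ_two (m : ℕ) (κ d : ℤ) :
    rightCoeff (m + 1) κ d 2 = rightCoeff m κ (d - 1) 0 + rightCoeff m (κ - 1) (d - 1) 1
      + rightCoeff m (κ - 1) (d - 1) 2 + if κ = -(m + 1 : ℕ) ∧ d = 0 then 4 ^ m else 0 := by
  obtain ⟨x, hx⟩ : ∃ x : ℤ, x = m - κ + d := ⟨_, rfl⟩
  obtain ⟨y, hy⟩ : ∃ y : ℤ, y = m + κ - d := ⟨_, rfl⟩
  rw [rightCoeff_of_two (x := x + 1) (y := y + 1) (by push_cast; omega) (by push_cast; omega),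
    rightCoeff_of_zero (x := x - 1) (y := y + 1) (by omega) (by omega),
    rightCoeff_of_one (x := x) (y := y) (by omega) (by omega),
    rightCoeff_of_two (x := x) (y := y) (by omega) (by omega)]
  have hS := tailPascal_eq_add (x - 1) κ
  have hC := choosePascal_eq_add y (d - 1)
  have e1 : tailPascal (x - 2) (κ - 1) * (if y = 0 ∧ d - 1 = 0 then 1 else 0)
      = if κ - 1 = -m ∧ d - 1 = 0 then freeWeight m 1 else 0 := by
    by_cases h : κ - 1 = -(m : ℤ) ∧ d - 1 = 0
    · rw [if_pos h, if_pos (by omega), mul_one, ← freeWeight_one, h.1]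
      congr 1; omega
    · rw [if_neg h, if_neg (by omega), mul_zero]
  have e2 : (if x - 1 = 0 ∧ κ ≤ 0 then 1 else 0) * choosePascal y (d - 1) = 0 := by
    by_cases h : x - 1 = 0 ∧ κ ≤ 0
    · rcases lt_or_ge (d - 1) 0 with hd | hd
      · rw [choosePascal_of_right_neg _ hd, mul_zero]
      · rw [choosePascal_of_neg (by omega), mul_zero]
    · rw [if_neg h, zero_mul]
  simp only [show x + 1 - 2 = x - 1 by ring, show y + 1 - 1 = y by ring,
    show x - 1 - 1 = x - 2 by ring] at *
  rw [show freeWeight (m + 1) 1 = 4 ^ m by simp [freeWeight]]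
  linear_combination choosePascal y (d - 1) * hS + tailPascal (x - 2) (κ - 1) * hC + e1 + e2

theorem rightCoeff_succ_one (m : ℕ) (κ d : ℤ) :
    rightCoeff (m + 1) κ d 1 = rightCoeff m κ d 0 + rightCoeff m (κ - 1) (d - 1) 1
      + rightCoeff m κ d 2 + if κ = -m ∧ d = 0 then freeWeight m 1 else 0 := by
  obtain ⟨x, hx⟩ : ∃ x : ℤ, x = m - κ + d := ⟨_, rfl⟩
  obtain ⟨y, hy⟩ : ∃ y : ℤ, y = m + κ - d := ⟨_, rfl⟩
  rw [rightCoeff_of_one (x := x + 1) (y := y + 1) (by push_cast; omega) (by push_cast; omega),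
    rightCoeff_of_zero (x := x) (y := y) (by omega) (by omega),
    rightCoeff_of_one (x := x) (y := y) (by omega) (by omega),
    rightCoeff_of_two (x := x) (y := y) (by omega) (by omega)]
  have hS := tailPascal_eq_add (x - 1) κ
  have hC := choosePascal_eq_add y d
  have e1 : tailPascal (x - 1) κ * (if y = 0 ∧ d = 0 then 1 else 0)
      = 2 * if κ = -m ∧ d = 0 then freeWeight m 1 else 0 := by
    by_cases h : κ = -(m : ℤ) ∧ d = 0
    · rw [if_pos h, if_pos (by omega), mul_one, ← two_mul_freeWeight_one m (k := κ) (by omega)]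
      congr 1; omega
    · rw [if_neg h, if_neg (by omega), mul_zero, mul_zero]
  have e2 : (if x - 1 = 0 ∧ κ ≤ 0 then 1 else 0) * choosePascal (y - 1) (d - 1) = 0 := by
    by_cases h : x - 1 = 0 ∧ κ ≤ 0
    · rcases lt_or_ge (d - 1) 0 with hd | hd
      · rw [choosePascal_of_right_neg _ hd, mul_zero]
      · rw [choosePascal_of_neg (by omega), mul_zero]
    · rw [if_neg h, zero_mul]
  simp only [show x + 1 - 2 = x - 1 by ring, show y + 1 - 1 = y by ring,
    show x - 1 - 1 = x - 2 by ring] at *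
  linear_combination choosePascal (y - 1) (d - 1) * hS + tailPascal (x - 1) κ * hC + e1 + e2

theorem rightCoeff_succ_zero (m : ℕ) (κ d : ℤ) :
    rightCoeff (m + 1) κ d 0 = rightCoeff (m + 1) κ d 1
      + rightCoeff m (κ - 1) (d - 1) 0 + rightCoeff m (κ - 1) d 1 + rightCoeff m (κ - 1) d 2
      + if κ = -m ∧ d = 0 then freeWeight m 0 else 0 := by
  obtain ⟨x, hx⟩ : ∃ x : ℤ, x = m - κ + d := ⟨_, rfl⟩
  obtain ⟨y, hy⟩ : ∃ y : ℤ, y = m + κ - d := ⟨_, rfl⟩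
  rw [rightCoeff_of_zero (x := x + 1) (y := y + 1) (by push_cast; omega) (by push_cast; omega),
    rightCoeff_of_one (x := x + 1) (y := y + 1) (by push_cast; omega) (by push_cast; omega),
    rightCoeff_of_zero (x := x) (y := y) (by omega) (by omega),
    rightCoeff_of_one (x := x + 1) (y := y - 1) (by omega) (by omega),
    rightCoeff_of_two (x := x + 1) (y := y - 1) (by omega) (by omega)]
  have hS := tailPascal_eq_add x κ
  have hC := choosePascal_eq_add y d
  have hC' := choosePascal_eq_add (y - 1) d
  have e1 : tailPascal (x - 1) (κ - 1) * (if y = 0 ∧ d = 0 then 1 else 0)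
      + (if x = 0 ∧ κ ≤ 0 then 1 else 0) * choosePascal y d
      = if κ = -m ∧ d = 0 then freeWeight m 0 else 0 := by
    by_cases h : κ = -(m : ℤ) ∧ d = 0
    · have hy0 : y = 0 := by omega
      have hx0 : x - 1 = 2 * m - 1 := by omega
      rw [if_pos h, if_pos ⟨hy0, h.2⟩, hx0, two_mul_freeWeight_one m (by omega), hy0, h.2,
        show choosePascal 0 0 = 1 by simp [choosePascal, pascal, pascalNat]]
      cases m with
      | zero => rw [if_pos (by omega)]; simp [freeWeight]
      | succ m => rw [if_neg (by omega)]; simp [freeWeight]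
    · rw [if_neg h, if_neg (by omega), mul_zero, zero_add]
      by_cases h' : x = 0 ∧ κ ≤ 0
      · rw [choosePascal_of_right_neg _ (by omega), mul_zero]
      · rw [if_neg h', zero_mul]
  have e2 : tailPascal (x - 1) (κ - 1) * (if y - 1 = 0 ∧ d = 0 then 1 else 0)
      = if κ - 1 = -m ∧ d = 0 then freeWeight m 1 else 0 := by
    by_cases h : κ - 1 = -(m : ℤ) ∧ d = 0
    · rw [if_pos h, if_pos (by omega), mul_one, ← freeWeight_one, h.1]
      congr 1; omega
    · rw [if_neg h, if_neg (by omega), mul_zero]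
  simp only [show x + 1 - 2 = x - 1 by ring, show y + 1 - 1 = y by ring,
    show y - 1 - 1 = y - 2 by ring, show x + 1 - 1 = x by ring] at *
  linear_combination choosePascal y d * hS + tailPascal (x - 1) (κ - 1) * (hC + hC') + e1 + e2

/-- The vector `|0, 1, 0, 1⟩` is left out because `V0R` differs from `V0` on it. `W1R` differs from
`W1` on `|0, 1, 2, 1⟩`, but for the vectors treated here `W` never meets it: `V` comes first and
either raises `w` or starts from another label. -/
theorem rightFunctional_ket_one (k W m c w : ℕ) (n : Fin 3) (h : ¬ (c = 0 ∧ w = 0 ∧ n = 0)) :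
    rightFunctional k W m (ket c (w + 1) n 1) = rightCoeff m (k - c) (W - m - (w + 1)) n := by
  induction m generalizing c w n with
  | zero =>
    rw [rightCoeff_zero, rightFunctional_zero]
    simp [ket]
  | succ m ih =>
    have hV0 : ∀ c w n, (V0R + V1) (ket c w n 0) = (V0 + V1) (ket c w n 0) := fun c w n =>
      VR_ket (by simp) (by simp)
    have hW0 : ∀ c w n, (W0R + W1R) (ket c w n 0) = (W0 + W1) (ket c w n 0) := fun c w n =>
      WR_ket (by simp) (by simp) (by simp)
    have hV : (V0R + V1) (ket c (w + 1) n 1) = (V0 + V1) (ket c (w + 1) n 1) :=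
      VR_ket (by omega) (by omega)
    have hW : ∀ c w n, ¬ (c = 0 ∧ w = 0 ∧ n = 2) →
        (W0R + W1R) (ket c (w + 1) n 1) = (W0 + W1) (ket c (w + 1) n 1) := fun c w n h =>
      WR_ket (by omega) (by omega) (by omega)
    have ih' : ∀ c w n, rightFunctional k W m (ket c (w + 2) n 1)
        = rightCoeff m (k - c) (W - m - (w + 2)) n := fun c w n => by
      have := ih c (w + 1) n (by omega)
      push_cast at this
      rw [show (W : ℤ) - m - (w + 2) = W - m - (w + 1 + 1) by ring, ← this]
    have ih3 : ∀ c w n, rightFunctional k W m (ket c (w + 3) n 1)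
        = rightCoeff m (k - c) (W - m - (w + 3)) n := fun c w n => by
      have := ih c (w + 2) n (by omega)
      push_cast at this
      rw [show (W : ℤ) - m - (w + 3) = W - m - (w + 2 + 1) by ring, ← this]
    have hA : ∀ c w n, rightFunctional k W m (ket c (w + 2) n 0)
        = if (k : ℤ) - c = -m ∧ (W : ℤ) - (m + 1 : ℕ) - (w + 1) = 0 then freeWeight m n else 0 := by
      intro c w n
      have e : ((k : ℤ) - c = -m ∧ (W : ℤ) - (m + 1 : ℕ) - (w + 1) = 0)
          ↔ (c = k + m ∧ w + 2 + m = W) := by omega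
      rw [rightFunctional_ket_zero]
      simp only [e]
    have d₁ : (W : ℤ) - m - (w + 2) = W - (m + 1 : ℕ) - (w + 1) := by push_cast; ring
    have d₃ : (W : ℤ) - m - ((w + 1 : ℕ) + 2) = W - (m + 1 : ℕ) - (w + 1) - 1 := by
      push_cast; ring
    have d₂ : (W : ℤ) - m - (w + 3) = W - (m + 1 : ℕ) - (w + 1) - 1 := by push_cast; ring
    have c₁ : (k : ℤ) - (c + 1 : ℕ) = k - c - 1 := by push_cast; ring
    rw [rightFunctional_succ, hV]
    fin_cases n
    · have hcw : ¬ (c = 0 ∧ w = 0) := fun h' => h ⟨h'.1, h'.2, rfl⟩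
      simp only [Fin.zero_eta, V_ket_zero_one, map_add]
      rw [hW0, W_ket_one_zero, hW c w 0 (by simp), W_ket_zero_one,
        show w + 2 = w + 1 + 1 by rfl, hW (c + 1) (w + 1) 1 (by simp), W_ket_one_one,
        hW c w 2 (by omega), W_ket_two_one]
      simp only [map_add, show w + 1 + 1 = w + 2 by rfl, show w + 1 + 2 = w + 3 by rfl, ih', hA,
        d₁, d₃, c₁]
      rw [rightCoeff_succ_zero, rightCoeff_succ_one]
      ring
    · simp only [Fin.mk_one, V_ket_one_one]
      rw [hW c w 0 (by simp), W_ket_zero_one]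
      simp only [map_add, ih', hA, d₁, d₃, c₁]
      rw [rightCoeff_succ_one]
      ring
    · have hA' : rightFunctional k W m ((W0 + W1) (ket c (w + 1) 1 0))
          + rightFunctional k W m ((W0 + W1) (ket c (w + 1) 2 0))
          = if (k : ℤ) - c = -(m + 1 : ℕ) ∧ (W : ℤ) - (m + 1 : ℕ) - (w + 1) = 0
            then 4 ^ m else 0 := by
        rw [← hW0, ← hW0]
        rcases c with _ | c
        · rw [hW0, hW0, W_ket_zero, W_ket_zero, if_neg (by push_cast; omega)]; simp
        · rw [hW0, hW0, W_ket_one_zero, W_ket_two_zero, map_add, hA, hA, hA]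
          have e : ((k : ℤ) - (c + 1 : ℕ) = -(m + 1 : ℕ)) ↔ ((k : ℤ) - c = -m) := by
            push_cast; omega
          simp only [e]
          split_ifs
          · cases m <;> simp [freeWeight]; ring
          · simp
      simp only [Fin.reduceFinMk, V_ket_two_one, map_add]
      rw [hW0, hW0, hA', show w + 2 = w + 1 + 1 by rfl, hW c (w + 1) 1 (by simp), W_ket_one_one,
        hW c (w + 1) 2 (by omega), W_ket_two_one]
      simp only [map_add, show w + 1 + 2 = w + 3 by rfl, ih3, d₂, c₁]
      rw [rightCoeff_succ_two]
      ring

/-! ### Evaluation on the boundary vector -/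

/-- The vectors that leave the sector of `⟨l'|` in one period. -/
def rightEmission : Aux :=
  ket 0 1 0 0 + (2 : ℝ) • ket 0 1 1 0 + ket 0 2 1 0 - (2 : ℝ) • ket 0 1 2 1
  + (2 : ℝ) • ket 0 2 0 1 + ket 0 2 2 1 + ket 0 3 0 1 + (2 : ℝ) • ket 1 3 1 1 + ket 1 3 2 1

theorem cDown_ket_one (w : ℕ) (n : Fin 3) (a : Fin 2) : cDown (ket 1 w n a) = ket 0 w n a :=
  cDown_ket_succ 0 w n a

theorem period_lVec' :
    (W0R + W1R) ((V0R + V1) lVec') = (4 : ℝ) • lVec' + rightEmission := by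
  have hV : (V0R + V1) lVec' = (2 : ℝ) • (ket 0 0 0 1 + ket 0 0 1 1 + ket 0 0 2 1)
      + ket 1 0 1 0 + ket 0 0 1 0 + ket 0 0 2 0 + ket 0 1 0 1 + (2 : ℝ) • ket 0 1 2 1 + ket 0 1 1 1
      + ket 0 1 1 0 + ket 0 1 2 0 + ket 0 2 1 1 + ket 0 2 2 1 := by
    simp [lVec', V0R, V0, V1, e_ket, E_ket, cUp_ket, wUp_ket, wDown_ket_zero, wDown_ket_succ]
    module
  rw [hV]
  simp [lVec', rightEmission, W0R, W1R, W0, W1, e_ket, E_ket, cUp_ket, wUp_ket, cDown_ket_zero,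
    cDown_ket_one, pow_two]
  module

/-- Needed for the induction step of `rightFunctional_lVec'`: the second factor there moves by two
rows, and the remaining terms match the emitted vectors. -/
theorem tailPascal_two_steps (B : ℤ) (d : ℕ) : tailPascal B (d - 1)
    = 4 * tailPascal (B - 2) d - 2 * choosePascal (B - 2) d + 2 * choosePascal (B - 1) d
      + 2 * choosePascal (B - 1) (d - 1) + choosePascal (B - 1) (d - 2)
      + if B = 0 ∧ d ≤ 1 then 1 else 0 := by
  have h1 := tailPascal_eq_add B (d - 1)
  have h2 := tailPascal_eq_add (B - 1) (d - 1)
  have h3 := tailPascal_eq_add (B - 1) (d - 2)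
  have h4 := choosePascal_eq_add (B - 1) d
  have h5 := choosePascal_eq_add (B - 1) (d - 1)
  have h6 := choosePascal_eq_add (B - 1) (d - 2)
  have h7 := tailPascal_sub_one (B - 2) d
  have h8 := tailPascal_sub_one (B - 2) (d - 1)
  have h9 := tailPascal_sub_one (B - 2) (d - 2)
  simp only [show (d : ℤ) - 1 - 1 = d - 2 by ring, show (d : ℤ) - 2 - 1 = d - 3 by ring,
    show B - 1 - 1 = B - 2 by ring] at *
  have e1 : (B = 0 ∧ (d : ℤ) - 1 ≤ 0) ↔ (B = 0 ∧ d ≤ 1) := by omega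
  have e2 : ((if B - 1 = 0 ∧ (d : ℤ) - 1 ≤ 0 then 1 else 0) : ℝ)
      + (if B - 1 = 0 ∧ (d : ℤ) - 2 ≤ 0 then 1 else 0)
      = 2 * (if B - 1 = 0 ∧ (d : ℤ) = 0 then 1 else 0)
      + 2 * (if B - 1 = 0 ∧ (d : ℤ) - 1 = 0 then 1 else 0)
      + (if B - 1 = 0 ∧ (d : ℤ) - 2 = 0 then 1 else 0) := by
    by_cases hB : B - 1 = 0
    · simp only [hB, true_and]
      rcases (by omega : d = 0 ∨ d = 1 ∨ d = 2 ∨ 2 < d) with h | h | h | h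
      · subst h; norm_num
      · subst h; norm_num
      · subst h; norm_num
      · rw [if_neg (by omega), if_neg (by omega), if_neg (by omega), if_neg (by omega),
          if_neg (by omega)]
        norm_num
    · simp [hB]
  simp only [e1] at h1
  linarith

/-- Only `d = 0` enters `R`. The index `d` is kept free because the row vector stays fixed while a
period is removed, so lowering `m` by one raises `d` by one. -/
theorem rightFunctional_lVec' (k m d : ℕ) : rightFunctional k (m + 1 + d) m lVec'
    = tailPascal (m - 2 - k + d) k * tailPascal (m - 1 + k - d) (d - 1) := by
  induction m generalizing d with
  | zero =>
    rw [rightFunctional_zero]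
    have h : lVec' (k, 0 + 1 + d, 0, 0) = 0 := by simp [lVec', ket]
    rw [h, eq_comm]
    rcases lt_or_ge ((0 : ℕ) - 2 - k + d : ℤ) 0 with h | h
    · rw [tailPascal_of_neg h, zero_mul]
    · rw [tailPascal_of_neg (n := (0 : ℕ) - 1 + k - d) (by omega), mul_zero]
  | succ m ih =>
    obtain ⟨A, hA⟩ : ∃ A : ℤ, A = m - 1 - k + d := ⟨_, rfl⟩
    obtain ⟨B, hB⟩ : ∃ B : ℤ, B = m + k - d := ⟨_, rfl⟩
    have ih' : rightFunctional k (m + 1 + 1 + d) m lVec'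
        = tailPascal A k * tailPascal (B - 2) d := by
      rw [show m + 1 + 1 + d = m + 1 + (d + 1) by ring, ih]
      congr 2 <;> push_cast <;> omega
    -- The emitted vectors with `a = 0` have `c = 0`, which could contribute only for `k = m = 0`;
    -- there either `w` does not fit or the label `n` has weight zero.
    have z : ∀ w n, n ≠ 2 → (w = 1 ∨ n = 1) →
        rightFunctional k (m + 1 + 1 + d) m (ket 0 w n 0) = 0 := by
      intro w n hn hw
      rw [rightFunctional_ket_zero]
      split_ifs with h
      · obtain rfl : m = 0 := by omega
        have : n = 1 := by omega
        simp [freeWeight, this]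
      · rfl
    have f := fun c w n h => rightFunctional_ket_one k (m + 1 + 1 + d) m c w n h
    have f1 : rightFunctional k (m + 1 + 1 + d) m (ket 0 1 2 1)
        = tailPascal A k * choosePascal (B - 2) d := by
      rw [f 0 0 2 (by simp), rightCoeff_of_two (x := A + 2) (y := B - 1) (by push_cast; omega)
        (by push_cast; omega), if_neg (by push_cast; omega), add_zero]
      congr 2 <;> push_cast <;> ring
    have f2 : rightFunctional k (m + 1 + 1 + d) m (ket 0 2 0 1)
        = tailPascal A k * choosePascal (B - 1) d := by
      rw [f 0 1 0 (by simp), rightCoeff_of_zero (x := A + 1) (y := B) (by push_cast; omega)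
        (by push_cast; omega)]
      congr 2 <;> push_cast <;> ring
    have f3 : rightFunctional k (m + 1 + 1 + d) m (ket 0 2 2 1)
        = tailPascal (A - 1) k * choosePascal (B - 1) (d - 1) := by
      rw [f 0 1 2 (by simp), rightCoeff_of_two (x := A + 1) (y := B) (by push_cast; omega)
        (by push_cast; omega)]
      have : (if (k : ℤ) - (0 : ℕ) = -m ∧ ((m + 1 + 1 + d : ℕ) : ℤ) - m - ((1 : ℕ) + 1) = 0
          then freeWeight m 1 else 0) = 0 := by
        split_ifs with h
        · obtain rfl : m = 0 := by omega
          simp [freeWeight]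
        · rfl
      rw [this, add_zero]
      congr 2 <;> push_cast <;> ring
    have f4 : rightFunctional k (m + 1 + 1 + d) m (ket 0 3 0 1)
        = tailPascal (A - 1) k * choosePascal B (d - 1) := by
      rw [f 0 2 0 (by simp), rightCoeff_of_zero (x := A) (y := B + 1) (by push_cast; omega)
        (by push_cast; omega)]
      congr 2 <;> push_cast <;> ring
    have f5 : rightFunctional k (m + 1 + 1 + d) m (ket 1 3 1 1)
        = tailPascal (A - 1) (k - 1) * choosePascal (B - 1) (d - 1) := by
      rw [f 1 2 1 (by simp), rightCoeff_of_one (x := A + 1) (y := B) (by push_cast; omega)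
        (by push_cast; omega)]
      congr 2 <;> push_cast <;> ring
    have f6 : rightFunctional k (m + 1 + 1 + d) m (ket 1 3 2 1)
        = tailPascal (A - 1) (k - 1) * choosePascal (B - 1) (d - 2)
          + if B = 0 ∧ (d : ℤ) - 1 = 0 then freeWeight m 1 else 0 := by
      rw [f 1 2 2 (by simp), rightCoeff_of_two (x := A + 1) (y := B) (by push_cast; omega)
        (by push_cast; omega)]
      have : ((k : ℤ) - (1 : ℕ) = -m ∧ ((m + 1 + 1 + d : ℕ) : ℤ) - m - ((2 : ℕ) + 1) = 0)
          ↔ (B = 0 ∧ (d : ℤ) - 1 = 0) := by omega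
      simp only [this]
      congr 3 <;> push_cast <;> ring
    have e : tailPascal A k * (if B = 0 ∧ d ≤ 1 then 1 else 0)
        + (if A = 0 ∧ (k : ℤ) ≤ 0 then 1 else 0)
          * (2 * choosePascal (B - 1) (d - 1) + choosePascal (B - 1) (d - 2))
        = tailPascal (A - 1) k * (if B = 0 ∧ (d : ℤ) - 1 = 0 then 1 else 0)
        + if B = 0 ∧ (d : ℤ) - 1 = 0 then freeWeight m 1 else 0 := by
      have e1 : (if A = 0 ∧ (k : ℤ) ≤ 0 then 1 else 0)
          * (2 * choosePascal (B - 1) (d - 1) + choosePascal (B - 1) (d - 2)) = 0 := by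
        split_ifs with h
        · rcases (by omega : d = 0 ∨ B - 1 < 0) with h' | h'
          · rw [choosePascal_of_right_neg _ (by omega), choosePascal_of_right_neg _ (by omega)]
            norm_num
          · rw [choosePascal_of_neg h', choosePascal_of_neg h']
            norm_num
        · rw [zero_mul]
      rw [e1, add_zero]
      by_cases h : B = 0 ∧ d ≤ 1
      · by_cases h' : m = 1
        · obtain rfl : k = 0 := by omega
          obtain rfl : A = (1 : ℕ) := by omega
          rw [if_pos h, if_pos (by omega), if_pos (by omega), tailPascal_of_nonpos _ (by simp), h',
            show ((1 : ℕ) : ℤ) - 1 = (0 : ℕ) by simp, tailPascal_of_nonpos _ (by simp)]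
          norm_num [freeWeight]
        · obtain rfl : m = 0 := by omega
          rw [tailPascal_of_neg (by omega), tailPascal_of_neg (by omega)]
          simp [freeWeight]
      · rw [if_neg h, if_neg (by omega), if_neg (by omega)]
        norm_num
    rw [rightFunctional_succ, period_lVec', rightEmission]
    simp only [map_add, map_sub, map_smul, smul_eq_mul, ih', f1, f2, f3, f4, f5, f6]
    rw [z 1 0 (by simp) (by simp), z 1 1 (by simp) (by simp), z 2 1 (by simp) (by simp),
      show ((m + 1 : ℕ) : ℤ) - 2 - k + d = A by push_cast; omega,
      show ((m + 1 : ℕ) : ℤ) - 1 + k - d = B by push_cast; omega]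
    have h1 := tailPascal_eq_add A k
    have h2 := choosePascal_eq_add B (d - 1)
    rw [show (d : ℤ) - 1 - 1 = d - 2 by ring] at h2
    linear_combination tailPascal (A - 1) k * h2 - tailPascal A k * tailPascal_two_steps B d - e
      - (2 * choosePascal (B - 1) (d - 1) + choosePascal (B - 1) (d - 2)) * h1

theorem R_eq_tailPascal (m k : ℕ) :
    R m (m + k) = tailPascal (m - 2 - k) k * tailPascal (m - 1 + k) (-1) := by
  have := rightFunctional_lVec' k m 0
  simp only [add_zero, Nat.cast_zero, sub_zero, zero_sub] at this
  rw [R_eq, this]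

theorem tailPascal_of_nonpos_right (n : ℤ) (hn : 0 ≤ n) {k : ℤ} (hk : k ≤ 0) :
    tailPascal n k = 2 ^ n := by
  obtain ⟨n, rfl⟩ := Int.eq_ofNat_of_zero_le hn
  rw [tailPascal_of_nonpos n hk, zpow_natCast]

/-- Where the first factor is nonzero, the second one is `2 ^ (m - 1 + k)`. Pascal's rule for the
first factor, with these powers of two, is the diagonal recursion. -/
theorem diagonalRec_R : DiagonalRec fun m k => R m (m + k) := by
  intro m k
  simp only [R_eq_tailPascal]
  have h1 := tailPascal_succ (m - 2 - k) (k + 1)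
  rw [if_neg (by omega), add_sub_cancel_right, add_zero] at h1
  have h2 : tailPascal ((m + 1 : ℕ) - 1 + (k + 1 : ℕ)) (-1) = 2 ^ ((m : ℤ) + k + 1) := by
    rw [tailPascal_of_nonpos_right _ (by omega) (by omega)]; push_cast; congr 1; ring
  have h3 : tailPascal ((m + 2 : ℕ) - 1 + (k + 1 : ℕ)) (-1) = 2 ^ ((m : ℤ) + k + 1) * 2 := by
    rw [tailPascal_of_nonpos_right _ (by omega) (by omega), ← zpow_add_one₀ two_ne_zero]
    push_cast; congr 1; ring
  have h4 : tailPascal (m - 2 - k) k * (8 * tailPascal (m - 1 + k) (-1))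
      = tailPascal (m - 2 - k) k * (2 ^ ((m : ℤ) + k + 1) * 2) := by
    rcases lt_or_ge ((m : ℤ) - 2 - k) 0 with h | h
    · rw [tailPascal_of_neg h, zero_mul, zero_mul]
    · rw [tailPascal_of_nonpos_right (m - 1 + k) (by omega) (by omega),
        show (m : ℤ) + k + 1 = m - 1 + k + 2 by ring,
        zpow_add₀ two_ne_zero (m - 1 + k : ℤ) 2, show (2 : ℝ) ^ (2 : ℤ) = 4 by norm_num]
      ring
  rw [h2, h3, show ((m + 2 : ℕ) : ℤ) - 2 - (k + 1 : ℕ) = m - 2 - k + 1 by push_cast; ring,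
    show ((m + 1 : ℕ) : ℤ) - 2 - (k + 1 : ℕ) = m - 2 - k by push_cast; ring,
    show ((k + 1 : ℕ) : ℤ) = k + 1 by push_cast; ring, h1]
  linear_combination - h4

theorem R_of_lt {m k : ℕ} (h : m < k + 2) : R m (m + k) = 0 := by
  rw [R_eq_tailPascal, tailPascal_of_neg (by omega), zero_mul]

theorem R_diag (m : ℕ) : R (m + 2) (m + 2 + 0) = 2 * 4 ^ m := by
  rw [R_eq_tailPascal, show ((m + 2 : ℕ) : ℤ) - 2 - (0 : ℕ) = m by push_cast; ring,
    show ((m + 2 : ℕ) : ℤ) - 1 + (0 : ℕ) = (m + 1 : ℕ) by push_cast; ring,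
    tailPascal_of_nonpos _ (by simp), tailPascal_of_nonpos _ (by simp), pow_succ,
    show (4 : ℝ) = 2 * 2 by norm_num, mul_pow]
  ring

/-! ### The matrix product and the dynamics -/

/-- The case `m = 0` of the comparison function is set to `0`. This is consistent with the
recursion, since `16 * (1/4) = 2 * 4 * (1/2) + 8 * 0`. -/
theorem diagonalDensity_eq (m k : ℕ) :
    diagonalDensity m (m + k) = if m = 0 then 0 else rayDensity k (m - 1) := by
  have h : L m (m + k) + R m (m + k) = if m = 0 then 0 else 4 ^ m * rayDensity k (m - 1) := by
    refine (diagonalRec_L.add diagonalRec_R).unique (g := fun m k =>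
      if m = 0 then 0 else 4 ^ m * rayDensity k (m - 1)) ?_ ?_ ?_ ?_ m k
    · intro m k
      cases m with
      | zero => norm_num [rayDensity_succ_one, rayDensity_zero_right]
      | succ m =>
        simp only [Nat.add_eq_zero_iff, one_ne_zero, and_false, if_false, OfNat.ofNat_ne_zero,
          Nat.add_sub_cancel, show m + 1 + 2 - 1 = m + 2 by rfl, rayDensity_succ]
        ring
    · intro k
      rw [L_zero, R_of_lt (by omega)]
      simp
    · intro k
      rw [L_one, R_of_lt (by omega)]
      norm_num [rayDensity_zero_right]
    · intro m
      rcases m with _ | _ | m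
      · rw [L_zero, R_of_lt (by omega)]
        simp
      · change L 1 (1 + 0) + R 1 (1 + 0) = _
        rw [L_one, R_of_lt (by omega)]
        norm_num [rayDensity_zero_right]
      · rw [L_diag, R_diag]
        simp [rayDensity_zero_left]
        ring
  rw [diagonalDensity, h, zpow_mul]
  split_ifs
  · simp
  · rw [zpow_natCast, ← mul_assoc, ← mul_pow]
    norm_num

/-! ### The closed expression -/

theorem binom_eq (n k : ℤ) : binom n k = choosePascal n k := by
  rcases lt_or_ge k 0 with hk | hk
  · rw [choosePascal_of_right_neg _ hk, binom, if_neg (by omega)]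
  rcases lt_or_ge n 0 with hn | hn
  · rw [choosePascal_of_neg hn, binom, if_neg (by omega)]
  obtain ⟨n, rfl⟩ := Int.eq_ofNat_of_zero_le hn
  obtain ⟨k, rfl⟩ := Int.eq_ofNat_of_zero_le hk
  rw [binom, if_pos ⟨hn, hk⟩, Int.toNat_natCast, Int.toNat_natCast]
  clear hn hk
  induction n generalizing k with
  | zero => cases k <;> simp [choosePascal, pascal, pascalNat]; omega
  | succ n ih =>
    rw [Nat.cast_succ, choosePascal_succ, if_neg (by omega), ← ih]
    cases k with
    | zero => rw [choosePascal_of_right_neg _ (by simp)]; simp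
    | succ k =>
      rw [Nat.cast_succ k, add_sub_cancel_right, ← ih, Nat.choose_succ_succ]
      push_cast; ring

theorem choosePascal_zero_left (k : ℤ) : choosePascal 0 k = if k = 0 then 1 else 0 := rfl

theorem choosePascal_zero_right (n : ℕ) : choosePascal n 0 = 1 := by
  rw [← binom_eq]; simp [binom]

theorem tailPascal_of_lt {n k : ℤ} (h : n < k) : tailPascal n k = 0 := by
  rcases lt_or_ge n 0 with hn | hn
  · exact tailPascal_of_neg hn k
  obtain ⟨n, rfl⟩ := Int.eq_ofNat_of_zero_le hn
  induction n generalizing k with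
  | zero => simp [tailPascal, pascal, pascalNat]; omega
  | succ n ih =>
    rw [Nat.cast_succ, tailPascal_succ, ih (by omega) (by omega), ih (by omega) (by omega),
      if_neg (by omega)]
    simp

theorem tailPascal_eq_sum (n k : ℤ) (l : ℕ) : tailPascal n k
    = ∑ i ∈ Finset.range l, choosePascal n (k + i) + tailPascal n (k + l) := by
  induction l with
  | zero => simp
  | succ l ih =>
    have h := tailPascal_sub_one n (k + l + 1)
    rw [add_sub_cancel_right] at h
    rw [ih, Finset.sum_range_succ, h, Nat.cast_succ, add_assoc (k : ℤ)]
    ring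

theorem sum_Icc_int (a b : ℤ) (f : ℤ → ℝ) :
    ∑ y ∈ Finset.Icc a b, f y = ∑ i ∈ Finset.range (b + 1 - a).toNat, f (a + i) := by
  refine (Finset.sum_map _ _ _).trans (Finset.sum_congr rfl fun i _ => ?_)
  simp

theorem sum_Icc_choosePascal (n k : ℤ) :
    ∑ y ∈ Finset.Icc k n, choosePascal n y = tailPascal n k := by
  rw [sum_Icc_int, tailPascal_eq_sum n k (n + 1 - k).toNat, tailPascal_of_lt (by omega), add_zero]

/-- The sum over the diagonals of the Pascal triangle. -/
def shallowSum (m k : ℕ) : ℝ :=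
  ∑ i ∈ Finset.range (m - k), (2 : ℝ) ^ (-((m : ℤ) - 1 - (k + i)))
    * choosePascal (m - 1 - (k + i)) (k + i)

/-- Pascal's rule, term by term. The sum for `m + 2` has one more term, which lies in row `0` at a
positive column and vanishes. -/
theorem shallowSum_rec (m k : ℕ) :
    shallowSum (m + 2) (k + 1) = shallowSum (m + 1) (k + 1) / 2 + shallowSum m k / 2 := by
  rcases lt_or_ge m k with h | h
  · simp [shallowSum, show m + 2 - (k + 1) = 0 by omega, show m + 1 - (k + 1) = 0 by omega,
      show m - k = 0 by omega]
  · obtain ⟨l, rfl⟩ := Nat.exists_eq_add_of_le h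
    simp only [shallowSum, show k + l + 2 - (k + 1) = l + 1 by omega,
      show k + l + 1 - (k + 1) = l by omega, show k + l - k = l by omega]
    rw [Finset.sum_range_succ, Finset.sum_div, Finset.sum_div, ← Finset.sum_add_distrib,
      show ((k + l + 2 : ℕ) : ℤ) - 1 - ((k + 1 : ℕ) + l) = 0 by push_cast; ring,
      choosePascal_zero_left, if_neg (by omega), mul_zero, add_zero]
    refine Finset.sum_congr rfl fun i hi => ?_
    have hi := Finset.mem_range.1 hi
    rw [show ((k + l + 2 : ℕ) : ℤ) - 1 - ((k + 1 : ℕ) + i) = l - i - 1 + 1 by push_cast; ring,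
      show ((k + l + 1 : ℕ) : ℤ) - 1 - ((k + 1 : ℕ) + i) = l - i - 1 by push_cast; ring,
      show ((k + l : ℕ) : ℤ) - 1 - (k + i) = l - i - 1 by push_cast; ring,
      choosePascal_succ, if_neg (by omega),
      show ((k + 1 : ℕ) : ℤ) + i - 1 = k + i by push_cast; ring, neg_add, zpow_add₀ two_ne_zero]
    norm_num
    ring

theorem shallowSum_succ_zero (m : ℕ) :
    shallowSum (m + 1) 0 = shallowSum (m + 1) 1 + 2 ^ (-(m : ℤ)) := by
  rw [shallowSum, Nat.sub_zero, Finset.sum_range_succ', shallowSum, Nat.add_sub_cancel]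
  congr 1
  · refine Finset.sum_congr rfl fun i _ => ?_
    simp [add_comm]
  · simp [choosePascal_zero_right]

/-- Together with the term split off at `y = 0`, `shallowSum_rec` gives `s (m+2) = (s (m+1) + s m) /
2`, whose characteristic roots are `1` and `-1/2`. Hence the term `(1 - (-1/2)^m) / 3` of the closed
expression is half the full sum. -/
theorem shallowSum_zero (m : ℕ) : shallowSum m 0 = 2 / 3 * (1 - (-1 / 2) ^ m) := by
  induction m using Nat.twoStepInduction with
  | zero => simp [shallowSum]
  | one => simp [shallowSum, choosePascal_zero_left]; norm_num
  | more m h₀ h₁ =>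
    have a := shallowSum_succ_zero (m + 1)
    have b := shallowSum_succ_zero m
    have c := shallowSum_rec m 0
    have d : (2 : ℝ) ^ (-((m + 1 : ℕ) : ℤ)) = 2 ^ (-(m : ℤ)) / 2 := by
      rw [Nat.cast_succ, neg_add, zpow_add₀ two_ne_zero]; norm_num; ring
    simp only [zero_add] at c
    change shallowSum (m + 1 + 1) 0 = _
    rw [a, c, d]
    rw [h₀] at *
    rw [h₁] at b
    rw [pow_succ, pow_succ] at *
    linarith

theorem shallowSum_of_le {m k : ℕ} (h : m ≤ k) : shallowSum m k = 0 := by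
  simp [shallowSum, Nat.sub_eq_zero_of_le h]

/-- The terms of the closed expression that depend on the row `n = 2m - t - 3`. -/
def rowTerm (n k : ℤ) : ℝ :=
  (2 : ℝ) ^ (-n) * (3 * choosePascal n (k - 1) + choosePascal n (k - 2) + tailPascal n k) / 8
  + 3 / 16 * ∑ i ∈ Finset.range n.toNat, (2 : ℝ) ^ (-(i : ℤ)) * choosePascal i (k - 1)

theorem rowTerm_of_neg {n : ℤ} (hn : n < 0) (k : ℤ) : rowTerm n k = 0 := by
  simp [rowTerm, choosePascal_of_neg hn, tailPascal_of_neg hn, Int.toNat_of_nonpos hn.le]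

theorem rowTerm_zero_left {k : ℤ} (hk : 0 < k) :
    rowTerm 0 k = 3 / 8 * (if k = 1 then 1 else 0) + 1 / 8 * if k = 2 then 1 else 0 := by
  rw [rowTerm, tailPascal_of_lt hk]
  simp [choosePascal_zero_left, sub_eq_zero]
  split_ifs <;> norm_num

theorem rowTerm_zero_right {n : ℤ} (hn : 0 ≤ n) : rowTerm n 0 = 1 / 8 := by
  have h : ∀ i : ℤ, choosePascal i (0 - 1) = 0 := fun i => choosePascal_of_right_neg i (by norm_num)
  have h' : choosePascal n (0 - 2) = 0 := choosePascal_of_right_neg n (by norm_num)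
  have h2 : (2 : ℝ) ^ n ≠ 0 := by positivity
  simp only [rowTerm, h, h', tailPascal_of_nonpos_right n hn le_rfl, zpow_neg]
  field_simp
  simp

theorem rowTerm_succ (n : ℕ) (k : ℤ) : rowTerm (n + 1) (k + 1)
    = rowTerm n (k + 1) / 2 + rowTerm n k / 2 + 3 / 16 * if k = 0 then 1 else 0 := by
  have e : ((n : ℤ) + 1).toNat = n + 1 := by omega
  simp only [rowTerm, e, Int.toNat_natCast]
  rw [Finset.sum_range_succ']
  have h : ∀ (i : ℕ) (l : ℤ), choosePascal (i + 1) l = choosePascal i l + choosePascal i (l - 1) :=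
    fun i l => by rw [choosePascal_succ, if_neg (by omega), add_zero]
  have hp : ∀ i : ℕ, (2 : ℝ) ^ (-((i : ℤ) + 1)) = 2 ^ (-(i : ℤ)) / 2 := fun i => by
    rw [neg_add, zpow_add₀ two_ne_zero]; norm_num; ring
  simp only [Nat.cast_succ, h, hp, tailPascal_succ,
    if_neg (show ¬ ((n : ℤ) = -1 ∧ k + 1 ≤ 0) by omega)]
  have hs : ∑ i ∈ Finset.range n, (2 : ℝ) ^ (-(i : ℤ)) / 2
      * (choosePascal i (k + 1 - 1) + choosePascal i (k + 1 - 1 - 1))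
      = (∑ i ∈ Finset.range n, (2 : ℝ) ^ (-(i : ℤ)) * choosePascal i (k + 1 - 1)) / 2
      + (∑ i ∈ Finset.range n, (2 : ℝ) ^ (-(i : ℤ)) * choosePascal i (k - 1)) / 2 := by
    rw [Finset.sum_div, Finset.sum_div, ← Finset.sum_add_distrib]
    refine Finset.sum_congr rfl fun i _ => ?_
    rw [show k + 1 - 1 - 1 = k - 1 by ring]; ring
  rw [hs, show ((0 : ℕ) : ℤ) = 0 by rfl, choosePascal_zero_left, show k + 1 - 1 = k by ring,
    show k + 1 - 2 = k - 1 by ring, show k - 1 - 1 = k - 2 by ring]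
  simp only [neg_zero, zpow_zero]
  ring

/-- The boundary terms of the closed expression. -/
def edgeTerm (m k : ℕ) : ℝ :=
  3 / 8 * (if k = 0 then 1 else 0)
  + 1 / 8 * ((if m = 1 ∧ k = 0 then 1 else 0) + if m = 2 ∧ k = 0 then 1 else 0)
  + 1 / 4 * if m = 3 ∧ k = 1 then 1 else 0

/-- The closed expression for the density at `t = m + k`. -/
def closedDensity (m k : ℕ) : ℝ :=
  edgeTerm m k + rowTerm (m - k - 3) k + (1 - (-1 / 2) ^ m) / 3 - shallowSum m k / 2

/-- The row terms start at row `0`, and there the Kronecker terms at `m = 1, 2, 3` supply the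
missing initial data. In later rows the defect `3/16` in `rowTerm_succ` is half of the edge value
`3/8` at `k = 0`. -/
theorem edgeTerm_add_rowTerm_rec (m k : ℕ) :
    edgeTerm (m + 3) (k + 1) + rowTerm (m - k - 1) (k + 1)
      = (edgeTerm (m + 2) (k + 1) + rowTerm (m - k - 2) (k + 1)) / 2
      + (edgeTerm (m + 1) k + rowTerm (m - k - 2) k) / 2 := by
  rcases lt_trichotomy ((m : ℤ) - k - 1) 0 with h | h | h
  · rw [rowTerm_of_neg h, rowTerm_of_neg (by omega), rowTerm_of_neg (by omega)]
    rcases m with _ | m <;> rcases k with _ | k <;> simp [edgeTerm] at h ⊢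
    · norm_num
    · omega
    · rw [if_neg (by omega), zero_div]
  · obtain rfl : m = k + 1 := by omega
    rw [h, rowTerm_zero_left (by omega), rowTerm_of_neg (by omega), rowTerm_of_neg (by omega)]
    rcases k with _ | _ | k <;> simp [edgeTerm] <;> norm_num
    rw [if_neg (by omega), if_neg (by omega)]; norm_num
  · obtain ⟨n, hn⟩ : ∃ n : ℕ, (m : ℤ) - k - 2 = n := Int.eq_ofNat_of_zero_le (by omega)
    rw [show (m : ℤ) - k - 1 = n + 1 by omega, hn, rowTerm_succ]
    have hm : 2 ≤ m := by omega
    obtain ⟨m, rfl⟩ := Nat.exists_eq_add_of_le' hm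
    rcases k with _ | k <;> simp [edgeTerm]
    · ring
    · rw [if_neg (by omega), if_neg (by omega)]; ring

theorem closedDensity_rec (m k : ℕ) : closedDensity (m + 3) (k + 1)
    = (closedDensity (m + 2) (k + 1) + closedDensity (m + 1) k) / 2 := by
  have h₁ := edgeTerm_add_rowTerm_rec m k
  have h₂ := shallowSum_rec (m + 1) k
  have h₃ : ((m + 3 : ℕ) : ℤ) - (k + 1 : ℕ) - 3 = m - k - 1 := by push_cast; ring
  have h₄ : ((m + 2 : ℕ) : ℤ) - (k + 1 : ℕ) - 3 = m - k - 2 := by push_cast; ring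
  have h₅ : ((m + 1 : ℕ) : ℤ) - k - 3 = m - k - 2 := by push_cast; ring
  simp only [closedDensity, h₃, h₄, h₅]
  rw [h₂, Nat.cast_succ k]
  linear_combination h₁

theorem closedDensity_zero_right (m : ℕ) : closedDensity (m + 1) 0 = 1 / 2 := by
  rw [closedDensity, shallowSum_zero]
  rcases m with _ | _ | m
  · rw [rowTerm_of_neg (by simp)]; norm_num [edgeTerm]
  · rw [rowTerm_of_neg (by simp)]; norm_num [edgeTerm]
  · rw [Nat.cast_zero, rowTerm_zero_right (by push_cast; omega)]
    simp [edgeTerm]; ring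

theorem closedDensity_one (k : ℕ) : closedDensity 1 (k + 1) = 1 / 2 := by
  rw [closedDensity, rowTerm_of_neg (by push_cast; omega), shallowSum_of_le (by omega)]
  norm_num [edgeTerm]

theorem closedDensity_two (k : ℕ) : closedDensity 2 (k + 1) = 1 / 4 := by
  rw [closedDensity, rowTerm_of_neg (by push_cast; omega), shallowSum_rec,
    shallowSum_of_le (by omega), shallowSum_of_le (by omega)]
  norm_num [edgeTerm]

theorem closedDensity_zero_left (k : ℕ) : closedDensity 0 (k + 1) = 0 := by
  rw [closedDensity, rowTerm_of_neg (by push_cast; omega), shallowSum_of_le (by omega)]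
  simp [edgeTerm]

theorem rayDensity_eq_closedDensity (k m : ℕ) : rayDensity k m = closedDensity (m + 1) k := by
  induction m using Nat.twoStepInduction generalizing k with
  | zero =>
    rw [rayDensity_zero_right]
    cases k with
    | zero => rw [closedDensity_zero_right]
    | succ k => rw [zero_add, closedDensity_one]
  | one =>
    cases k with
    | zero => rw [rayDensity_zero_left, closedDensity_zero_right]
    | succ k => rw [rayDensity_succ_one, closedDensity_two]
  | more m h₀ h₁ =>
    cases k with
    | zero => rw [rayDensity_zero_left, closedDensity_zero_right]
    | succ k => rw [rayDensity_succ, h₀, h₁, closedDensity_rec]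

theorem diagonalDensity_eq_closedDensity {m k : ℕ} (h : 1 ≤ m + k) :
    diagonalDensity m (m + k) = closedDensity m k := by
  rw [diagonalDensity_eq]
  cases m with
  | zero =>
    obtain ⟨k, rfl⟩ := Nat.exists_eq_add_of_le' (show 1 ≤ k by omega)
    rw [closedDensity_zero_left]; rfl
  | succ m => rw [if_neg (by omega), Nat.add_sub_cancel, rayDensity_eq_closedDensity]

theorem closedDensity_eq (m k : ℕ) : closedDensity m k
    = 3 / 8 * delta m (m + k)
        + 1 / 8 * (delta m 1 * delta (m + k) 1 + delta m 2 * delta (m + k) 2)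
        + 1 / 4 * (delta m 3 * delta (m + k) 4)
        + theta (2 * m - (m + k : ℕ) - 3) * (2 : ℝ) ^ (((m + k : ℕ) : ℤ) - 2 * m)
          * (3 * binom (2 * m - (m + k : ℕ) - 3) ((m + k : ℕ) - m - 1)
            + binom (2 * m - (m + k : ℕ) - 3) ((m + k : ℕ) - m - 2))
        + (1 - (-1 / 2 : ℝ) ^ m) / 3
        - 1 / 2 * ∑ y ∈ Finset.Icc (((m + k : ℕ) : ℤ) - m) ((m : ℤ) - 1),
            (2 : ℝ) ^ (-((m : ℤ) - 1 - y)) * binom (m - 1 - y) y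
        + 1 / 8 * ∑ y ∈ Finset.Icc (((m + k : ℕ) : ℤ) - m) (2 * (m : ℤ) - (m + k : ℕ) - 3),
            (2 : ℝ) ^ (-(2 * (m : ℤ) - (m + k : ℕ) - 3)) * binom (2 * m - (m + k : ℕ) - 3) y
        + 3 / 16 * ∑ y ∈ Finset.Icc (0 : ℤ) (2 * (m : ℤ) - (m + k : ℕ) - 4),
            (2 : ℝ) ^ (-y) * binom y ((m + k : ℕ) - m - 1) := by
  obtain ⟨n, hn⟩ : ∃ n : ℤ, n = m - k - 3 := ⟨_, rfl⟩
  rw [show ((m + k : ℕ) : ℤ) - m = k by push_cast; ring,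
    show 2 * (m : ℤ) - (m + k : ℕ) - 3 = n by push_cast; omega,
    show 2 * (m : ℤ) - (m + k : ℕ) - 4 = n - 1 by push_cast; omega,
    show ((m + k : ℕ) : ℤ) - 2 * m = -n + (-3) by push_cast; omega,
    zpow_add₀ two_ne_zero, ← Finset.mul_sum]
  simp only [binom_eq]
  rw [sum_Icc_choosePascal, sum_Icc_int, sum_Icc_int, closedDensity, ← hn, rowTerm, shallowSum,
    show ((m : ℤ) - 1 + 1 - k).toNat = m - k by omega, show n - 1 + 1 - 0 = n by ring]
  -- With `n = 2m - t - 3` the power `2^(t - 2m)` is `2^(-n) / 8`. The factor `theta n` is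
  -- redundant, since `choosePascal` vanishes in negative rows.
  have ht : theta n * ((2 : ℝ) ^ (-n) * 2 ^ (-3 : ℤ))
        * (3 * choosePascal n (k - 1) + choosePascal n (k - 2))
      = (2 : ℝ) ^ (-n) / 8 * (3 * choosePascal n (k - 1) + choosePascal n (k - 2)) := by
    rcases lt_or_ge n 0 with h | h
    · simp [choosePascal_of_neg h]
    · rw [theta, if_pos h, show (2 : ℝ) ^ (-3 : ℤ) = 1 / 8 by norm_num]; ring
  have he : edgeTerm m k = 3 / 8 * delta m (m + k)
        + 1 / 8 * (delta m 1 * delta (m + k) 1 + delta m 2 * delta (m + k) 2)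
        + 1 / 4 * (delta m 3 * delta (m + k) 4) := by
    have d : ∀ a b c l : ℕ, b = a + c → delta m a * delta (m + k) b
        = if m = a ∧ k = c then 1 else 0 := fun a b c l h => by
      subst h
      by_cases hm : m = a
      · subst hm; simp [delta]
      · simp [delta, hm]
    rw [d 1 1 0 0 rfl, d 2 2 0 0 rfl, d 3 4 1 0 rfl, edgeTerm, delta]
    simp
  rw [ht, he]
  simp only [zero_add]
  ring

theorem densityProfile_eq_diagonalDensity (x : ℤ) (t m : ℕ) (h₁ : -(t : ℤ) < x) (h₂ : x < t)
    (h : (t : ℤ) - x + 1 = 2 * m) : densityProfile x t = diagonalDensity m t := by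
  obtain ⟨m, rfl⟩ := Nat.exists_eq_add_of_le' (show 1 ≤ m by omega)
  obtain ⟨k, rfl⟩ := Nat.exists_eq_add_of_le (show m + 1 ≤ t by omega)
  rw [diagonalDensity_eq, if_neg (by omega), Nat.add_sub_cancel, ← densityProfile_of_odd]
  congr 1
  push_cast at h
  omega

end Rule54

end

theorem mainTheorem2 :
    (∀ m t : ℕ, 1 ≤ t → m ≤ t →
      diagonalDensity m t =
        3 / 8 * delta m t + 1 / 8 * (delta m 1 * delta t 1 + delta m 2 * delta t 2)
        + 1 / 4 * (delta m 3 * delta t 4)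
        + theta (2 * m - t - 3) * (2 : ℝ) ^ ((t : ℤ) - 2 * m)
          * (3 * binom (2 * m - t - 3) (t - m - 1) + binom (2 * m - t - 3) (t - m - 2))
        + (1 - (-1 / 2 : ℝ) ^ m) / 3
        - 1 / 2 * ∑ y ∈ Finset.Icc ((t : ℤ) - m) ((m : ℤ) - 1),
            (2 : ℝ) ^ (-((m : ℤ) - 1 - y)) * binom (m - 1 - y) y
        + 1 / 8 * ∑ y ∈ Finset.Icc ((t : ℤ) - m) (2 * (m : ℤ) - t - 3),
            (2 : ℝ) ^ (-(2 * (m : ℤ) - t - 3)) * binom (2 * m - t - 3) y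
        + 3 / 16 * ∑ y ∈ Finset.Icc (0 : ℤ) (2 * (m : ℤ) - t - 4),
            (2 : ℝ) ^ (-y) * binom y (t - m - 1))
    ∧ (∀ (x : ℤ) (t : ℕ), x ≤ -(t : ℤ) → densityProfile x t = 1 / 2)
    ∧ (∀ (x : ℤ) (t : ℕ), 1 ≤ t ∨ 1 ≤ x → (t : ℤ) ≤ x → densityProfile x t = 0)
    ∧ (∀ (x : ℤ) (t m : ℕ), -(t : ℤ) < x → x < t → (t : ℤ) - x = 2 * m →
        densityProfile x t = diagonalDensity m (t - 1))
    ∧ (∀ (x : ℤ) (t m : ℕ), -(t : ℤ) < x → x < t → (t : ℤ) - x + 1 = 2 * m →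
        densityProfile x t = diagonalDensity m t) := by
  refine ⟨fun m t ht hm => ?_, densityProfile_left, densityProfile_right, fun x t m h₁ h₂ h => ?_,
    densityProfile_eq_diagonalDensity⟩
  · obtain ⟨k, rfl⟩ := Nat.exists_eq_add_of_le hm
    rw [diagonalDensity_eq_closedDensity ht, closedDensity_eq]
  · obtain ⟨t, rfl⟩ := Nat.exists_eq_add_of_le' (show 1 ≤ t by omega)
    push_cast at h h₁ h₂
    -- The site is not updated in the last step. At the earlier time `x + t` is odd, so the weak
    -- bounds `-t ≤ x ≤ t` are automatically strict.
    rw [densityProfile_of_even x t (by omega), Nat.add_sub_cancel]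
    exact densityProfile_eq_diagonalDensity x t m (by omega) (by omega) (by omega)
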